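/- Let $\mathcal U$ be the set of non-empty compact subsets of $\mathbb C$ with the Borel $\sigma$-algebra of the Hausdorff topology, and let $\mu$ be a measure on $\mathcal U$ such that: - $\mu$-almost every $\gamma$ is a simple loop, i.e. the image of an injective continuous map from the unit circle to $\mathbb C$; - $\mu$ is invariant under $\gamma\mapsto z+\gamma$ for all $z\in\mathbb C$ and under $\gamma\mapsto\rho\gamma$ for all $\rho>0$; - $\mu$ is locally finite: the $\mu$-mass of the set of $\gamma$ of diameter greater than $1$ that are contained in a given $2\times 2$ square is finite; - $\mu$ is not one-dimensional: for every $\theta\in\mathbb R$, $\mu(\{\gamma:\exists x,y\in\gamma,\ x-y\notin e^{i\theta}\mathbb R\})\neq 0$; - $\mu$ is thin: for some $R>0$, the $\mu$-mass of the set of $\gamma$ of diameter at least $R$ that intersect the unit disk is finite. Let $\Gamma$ be a Poisson point process with intensity $\mu$ (the soup in the plane), defined on a probability space with probability $P$. The interior of a simple loop $\gamma$ is the bounded connected component of $\mathbb C\setminus\gamma$; a loop surrounds a point if the point lies in its interior; two loops cross if each of them intersects the interior of the other. Assume that $\Gamma$ is subcritical: with positive probability there is a simple closed loop (not necessarily in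 $\Gamma$) that surrounds the origin and crosses no loop of $\Gamma$. For $\epsilon\in(0,1)$ let $\Gamma_\epsilon$ be the set of loops of $\Gamma$ contained in the ring $\{\epsilon<|z|<1\}$, and let $A_\epsilon$ be the event that there is a continuous path from $0$ to the unit circle that does not meet the interior of any loop of $\Gamma_\epsilon$. Then: 1. There exist $k>0$ and $R>2$ such that for all $\epsilon,\epsilon'\in(0,1/R)$, $$k\,P(A_\epsilon)\,P(A_{\epsilon'/R})\le P(A_{\epsilon\epsilon'})\le P(A_\epsilon)\,P(A_{\epsilon'}).$$ 2. There exist constants $0<\alpha<\infty$ and $0<k'<\infty$ such that for all $\epsilon\in(0,1)$, $$\epsilon^\alpha\le P(A_\epsilon)\le k'\epsilon^\alpha.$$ -/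

import Mathlib

open MeasureTheory ProbabilityTheory TopologicalSpace
open scoped ENNReal

noncomputable section

namespace LoopSoup

/-- Planar curves, seen as nonempty compact subsets of the plane. Their topology is the
topology of the Hausdorff distance. -/
abbrev Curve : Type := NonemptyCompacts ℂ

/-- The Borel sigma-algebra of the Hausdorff topology. -/
instance instMeasurableSpaceCurve : MeasurableSpace Curve := borel Curve

instance instBorelSpaceCurve : BorelSpace Curve := ⟨rfl⟩

/-- The translation `γ ↦ z + γ`. -/
def translate (z : ℂ) (γ : Curve) : Curve :=
  γ.map (fun w => z + w) (by fun_prop)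

/-- The scaling `γ ↦ ρ γ`. -/
def scale (ρ : ℝ) (γ : Curve) : Curve :=
  γ.map (fun w => (ρ : ℂ) * w) (by fun_prop)

/-- `γ` is a simple loop: the image of the unit circle under an injective continuous map. -/
def IsSimpleLoop (γ : Curve) : Prop :=
  ∃ f : Circle → ℂ, Continuous f ∧ Function.Injective f ∧ Set.range f = (γ : Set ℂ)

/-- The interior of a loop `γ`: the points off `γ` whose connected component in the complement
of `γ` is bounded. For a simple loop, there is exactly one bounded component. -/
def inside (γ : Curve) : Set ℂ :=
  {z | z ∉ (γ : Set ℂ) ∧ Bornology.IsBounded (connectedComponentIn (γ : Set ℂ)ᶜ z)}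

/-- Two loops cross if each one of the two intersects the interior of the other one. -/
def Cross (γ γ' : Curve) : Prop :=
  ((γ : Set ℂ) ∩ inside γ').Nonempty ∧ ((γ' : Set ℂ) ∩ inside γ).Nonempty

/-- The closed `2 × 2` square with lower left corner `a`. -/
def square (a : ℂ) : Set ℂ :=
  {z | z.re ∈ Set.Icc a.re (a.re + 2) ∧ z.im ∈ Set.Icc a.im (a.im + 2)}

/-- The measures on curves that are translation-invariant, scale-invariant, locally finite and
not one-dimensional. -/
structure IsInvariantMeasure (μ : Measure Curve) : Prop where
  translation_invariant : ∀ z : ℂ, MeasurePreserving (translate z) μ μ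
  scale_invariant : ∀ ρ : ℝ, 0 < ρ → MeasurePreserving (scale ρ) μ μ
  locally_finite : ∀ a : ℂ,
    μ {γ | 1 < Metric.diam (γ : Set ℂ) ∧ (γ : Set ℂ) ⊆ square a} < ∞
  not_one_dimensional : ∀ θ : ℝ,
    μ {γ | ∃ x ∈ (γ : Set ℂ), ∃ y ∈ (γ : Set ℂ),
      ¬ ∃ t : ℝ, x - y = Complex.exp (θ * Complex.I) * t} ≠ 0

/-- For some `R > 0`, the mass of the curves of diameter at least `R` that intersect the unit
disk is finite. -/
def IsThin (μ : Measure Curve) : Prop :=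
  ∃ R : ℝ, 0 < R ∧
    μ {γ | ((γ : Set ℂ) ∩ Metric.ball 0 1).Nonempty ∧ R ≤ Metric.diam (γ : Set ℂ)} < ∞

/-- `Γ` is a Poisson point process on `E` with intensity `μ`, defined on the probability space
`(Ω, P)`: a random countable subset of `E` whose numbers of points in disjoint measurable sets
are independent Poisson variables with means given by `μ` (almost surely infinite when the mean
is infinite). -/
structure IsPoissonPointProcess {Ω E : Type*} [MeasurableSpace Ω] [MeasurableSpace E]
    (P : Measure Ω) (Γ : Ω → Set E) (μ : Measure E) : Prop where
  countable : ∀ ω, (Γ ω).Countable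
  measurable_count : ∀ A : Set E, MeasurableSet A → Measurable fun ω => (Γ ω ∩ A).encard
  count_poisson : ∀ A : Set E, MeasurableSet A → μ A ≠ ∞ → ∀ n : ℕ,
    P {ω | (Γ ω ∩ A).encard = n} = poissonMeasure (μ A).toNNReal {n}
  count_infinite : ∀ A : Set E, MeasurableSet A → μ A = ∞ →
    ∀ᵐ ω ∂P, (Γ ω ∩ A).encard = ⊤
  count_indep : ∀ (n : ℕ) (A : Fin n → Set E), (∀ i, MeasurableSet (A i)) →
    Pairwise (fun i j => Disjoint (A i) (A j)) →
    iIndepFun (fun i ω => (Γ ω ∩ A i).encard) P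

/-- Subcriticality of the soup `Γ` in the plane: with positive probability there is a closed
loop (not necessarily in the soup) that surrounds the origin and crosses no loop of the soup. -/
def IsSubcritical {Ω : Type*} [MeasurableSpace Ω] (P : Measure Ω) (Γ : Ω → Set Curve) : Prop :=
  0 < P {ω | ∃ l : Curve, IsSimpleLoop l ∧ (0 : ℂ) ∈ inside l ∧ ∀ γ ∈ Γ ω, ¬ Cross l γ}

/-- The curves of the family `S` that are contained in the ring `{ε < |z| < 1}`. -/
def restrictRing (ε : ℝ) (S : Set Curve) : Set Curve :=
  {γ ∈ S | ∀ z ∈ (γ : Set ℂ), ε < ‖z‖ ∧ ‖z‖ < 1}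

/-- The event `A_ε`: there is a path from the origin to the unit circle that does not meet the
interior of any curve of the soup contained in the ring `{ε < |z| < 1}`. -/
def eventA {Ω : Type*} (Γ : Ω → Set Curve) (ε : ℝ) : Set Ω :=
  {ω | ∃ (w : ℂ) (p : Path (0 : ℂ) w), ‖w‖ = 1 ∧
    ∀ γ ∈ restrictRing ε (Γ ω), ∀ t, p t ∉ inside γ}

end LoopSoup

end

/-! Removing loops only helps a path, so `A_ε` is a decreasing event of the soup.

Upper bound: a path realising `A_{εε'}` also realises `A_ε` and the analogous event for the ring
`{εε' < |z| < ε}`. No loop lies in both rings, so these two events are independent, and by scale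
invariance the second has probability `P(A_ε')`.

Lower bound: intersect a path event in `{ε < |z| < 1}` with one in `{εε' < |z| < Rε}`, and ask
moreover for a circuit around the origin in the overlap `{ε < |z| < Rε}` and for no loop crossing
this overlap. These four events are decreasing, so the Harris-FKG inequality bounds the probability
of their intersection below by the product. The last two have probabilities bounded below
independently of `ε`, by subcriticality and by thinness; together they give `k`. On the intersection
the two paths are joined along the circuit (`HasPath.glue`).

Exponent: `g(t) = -log P(A_{exp(-t)})` is nondecreasing, superadditive and almost subadditive, hence
`g(t) = αt + O(1)` with `α = sup g(t)/t` (`exists_linear_growth`); the supremum explains the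
constant `1` on the left. The logarithm requires `P(A_ε) > 0`, obtained by FKG from a chain of small
circuits along `[0,1]`, and `α > 0` requires `P(A_ε) < 1` for some `ε`, which holds since a loop of
the ring may surround the origin.

Two technical supports. From the Jordan curve theorem only two facts are needed: a simple loop has a
bounded complementary component, and the closure of any such component contains the loop. As for
measurability, the existence of a path is a projection, so it is an analytic property of countably
many vacancy indicators; FKG, independence and invariance are therefore proved for all such
properties (`IsDecreasing`), by way of capacitability. -/

namespace LoopSoup

open Set Filter Topology

/-! ### Continuous logarithms. -/

section Logarithm

theorem eqOn_of_exp_eqOn {X : Type*} [TopologicalSpace X] {s : Set X} (hs : IsPreconnected s)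
    {f g : X → ℂ} (hf : ContinuousOn f s) (hg : ContinuousOn g s)
    (h : ∀ x ∈ s, Complex.exp (f x) = Complex.exp (g x)) {a : X} (ha : a ∈ s) (hfg : f a = g a) :
    EqOn f g s :=
  Complex.isCoveringMap_exp.eqOn_of_comp_eqOn hs hf hg
    (fun x hx => Subtype.ext (h x hx)) ha hfg

theorem exists_log {X : Type*} [TopologicalSpace X] [SimplyConnectedSpace X]
    [LocallyPathConnectedSpace X] {h : X → ℂ} (hc : Continuous h) (h0 : ∀ x, h x ≠ 0) :
    ∃ g : X → ℂ, Continuous g ∧ ∀ x, Complex.exp (g x) = h x := by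
  obtain ⟨x₀⟩ : Nonempty X := inferInstance
  let H : C(X, {z : ℂ // z ≠ 0}) := ⟨fun x => ⟨h x, h0 x⟩, by fun_prop⟩
  obtain ⟨F, ⟨-, hF⟩, -⟩ := Complex.isCoveringMap_exp.existsUnique_continuousMap_lifts
    H x₀ (Complex.log (h x₀)) (Subtype.ext (Complex.exp_log (h0 x₀)))
  exact ⟨F, F.continuous, fun x => congrArg Subtype.val (congrFun hF x)⟩

/-- Along one turn of the circle, a continuous logarithm of `z - a` would increase by `2πi`,
although the endpoint equals the starting point. -/
theorem not_exists_log_sphere (a : ℂ) {r : ℝ} (hr : 0 < r) (g : ℂ → ℂ)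
    (hg : ContinuousOn g (Metric.sphere a r))
    (h : ∀ z ∈ Metric.sphere a r, Complex.exp (g z) = z - a) : False := by
  let e : ℝ → ℂ := fun θ => a + r * Complex.exp (θ * Complex.I)
  have he : ∀ θ, e θ ∈ Metric.sphere a r := fun θ => by
    simp [e, Complex.norm_exp_ofReal_mul_I, abs_of_pos hr]
  have hec : Continuous e := by fun_prop
  have hr' : (r : ℂ) ≠ 0 := by exact_mod_cast hr.ne'
  have key := eqOn_of_exp_eqOn (isPreconnected_univ (α := ℝ)) (f := fun θ => g (e θ))
    (g := fun θ => g (e 0) + θ * Complex.I)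
    ((hg.comp_continuous hec he).continuousOn) (by fun_prop) (a := 0)
    (fun θ _ => by
      rw [Complex.exp_add, h _ (he θ), h _ (he 0)]
      simp [e]) (mem_univ _) (by simp)
  have h2 := key (mem_univ (2 * Real.pi))
  have h3 : e (2 * Real.pi) = e 0 := by simp [e]
  simp only [h3] at h2
  have : (2 * Real.pi : ℂ) * Complex.I = 0 := by
    have := h2
    push_cast at this
    linear_combination -this
  simp [Real.pi_ne_zero] at this

end Logarithm

/-! ### Bounded complementary components and filled sets. -/

section Components

variable {K : Set ℂ}

/-- The points off `K` whose connected component in the complement of `K` is bounded. -/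
def insideSet (K : Set ℂ) : Set ℂ :=
  {z | z ∉ K ∧ Bornology.IsBounded (connectedComponentIn Kᶜ z)}

theorem inside_eq_insideSet (γ : Curve) : inside γ = insideSet (γ : Set ℂ) := rfl

/-- Components of an open set are open, so a limit point off `K` has a component that meets, hence
equals, the given one. -/
theorem closure_connectedComponentIn_subset (hK : IsClosed K) (z : ℂ) :
    closure (connectedComponentIn Kᶜ z) ⊆ connectedComponentIn Kᶜ z ∪ K := by
  intro y hy
  by_contra hcon
  simp only [mem_union, not_or] at hcon
  have hop : IsOpen (connectedComponentIn Kᶜ y) := hK.isOpen_compl.connectedComponentIn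
  have hmem : y ∈ connectedComponentIn Kᶜ y := mem_connectedComponentIn hcon.2
  obtain ⟨w, hw1, hw2⟩ := mem_closure_iff.1 hy _ hop hmem
  rw [connectedComponentIn_eq hw1, ← connectedComponentIn_eq hw2] at hmem
  exact hcon.1 hmem

theorem mem_insideSet_of_mem {z w : ℂ} (hz : z ∈ insideSet K)
    (hw : w ∈ connectedComponentIn Kᶜ z) : w ∈ insideSet K :=
  ⟨connectedComponentIn_subset _ _ hw, by rw [← connectedComponentIn_eq hw]; exact hz.2⟩

theorem connectedComponentIn_subset_insideSet {z : ℂ} (hz : z ∈ insideSet K) :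
    connectedComponentIn Kᶜ z ⊆ insideSet K := fun _ hw => mem_insideSet_of_mem hz hw

theorem isOpen_insideSet (hK : IsClosed K) : IsOpen (insideSet K) := by
  rw [isOpen_iff_forall_mem_open]
  intro z hz
  exact ⟨_, connectedComponentIn_subset_insideSet hz, hK.isOpen_compl.connectedComponentIn,
    mem_connectedComponentIn hz.1⟩

/-- A preconnected set off `K` that meets the inside of `K` stays inside. -/
theorem subset_insideSet_of_isPreconnected {s : Set ℂ} (hs : IsPreconnected s)
    (hd : Disjoint s K) {z : ℂ} (hz : z ∈ s) (hzK : z ∈ insideSet K) : s ⊆ insideSet K :=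
  (hs.subset_connectedComponentIn hz hd.subset_compl_right).trans
    (connectedComponentIn_subset_insideSet hzK)

/-- Polar coordinates about `c` present the set as an image of a half-line times a circle; `max R 0`
covers negative `R`, where the ball is empty. -/
theorem isPreconnected_compl_ball (c : ℂ) (R : ℝ) : IsPreconnected (Metric.ball c R)ᶜ := by
  have h : (Metric.ball c R)ᶜ
      = (fun p : ℝ × ℂ => c + (p.1 : ℂ) * p.2) '' (Ici (max R 0) ×ˢ Metric.sphere (0 : ℂ) 1) := by
    ext z
    simp only [mem_compl_iff, mem_ball_iff_norm, not_lt, mem_image, mem_prod,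
      mem_Ici, mem_sphere_iff_norm, sub_zero, Prod.exists]
    constructor
    · intro hz
      by_cases h0 : z = c
      · subst h0
        exact ⟨0, 1, ⟨by simpa using hz, by simp⟩, by simp⟩
      · refine ⟨‖z - c‖, (z - c) / ‖z - c‖, ⟨by simpa using hz, by simp [sub_ne_zero.2 h0]⟩, ?_⟩
        have : (‖z - c‖ : ℂ) ≠ 0 := by simpa [sub_eq_zero] using h0
        field_simp
        ring
    · rintro ⟨r, u, ⟨h1, h2⟩, rfl⟩
      simp only [add_sub_cancel_left, norm_mul, Complex.norm_real, h2, mul_one, Real.norm_eq_abs]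
      exact (le_max_left _ _).trans (h1.trans (le_abs_self r))
  rw [h]
  exact (isPreconnected_Ici.prod (isPreconnected_sphere (by simp) 0 1)).image _ (by fun_prop)

theorem not_isBounded_compl_ball (c : ℂ) (R : ℝ) :
    ¬ Bornology.IsBounded (Metric.ball c R)ᶜ := by
  intro h
  have := h.union (Metric.isBounded_ball (x := c) (r := R))
  rw [compl_union_self] at this
  exact NoncompactSpace.noncompact_univ (X := ℂ)
    (Metric.isCompact_of_isClosed_isBounded isClosed_univ this)

theorem not_isBounded_connectedComponentIn {c z : ℂ} {R : ℝ} (h : K ⊆ Metric.ball c R)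
    (hz : z ∉ Metric.ball c R) : ¬ Bornology.IsBounded (connectedComponentIn Kᶜ z) := fun hb =>
  not_isBounded_compl_ball c R (hb.subset
    ((isPreconnected_compl_ball c R).subset_connectedComponentIn hz (compl_subset_compl.2 h)))

/-- Nothing outside a ball that contains `K` is inside `K`. -/
theorem insideSet_subset_ball {c : ℂ} {R : ℝ} (h : K ⊆ Metric.ball c R) :
    insideSet K ⊆ Metric.ball c R := fun _ hz => by
  by_contra hcon
  exact not_isBounded_connectedComponentIn h hcon hz.2

/-- The first point at which a path meets a closed set. -/
theorem exists_joinedIn_first_hit {x y : ℂ} (p : Path x y) (hK : IsClosed K)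
    (h : ∃ t, p t ∈ K) :
    ∃ z ∈ K, JoinedIn (range p ∩ (K ∪ connectedComponentIn Kᶜ x)) x z := by
  by_cases hx : x ∈ K
  · exact ⟨x, hx, JoinedIn.refl ⟨⟨0, p.source⟩, Or.inl hx⟩⟩
  let T : Set unitInterval := p ⁻¹' K
  have hT : IsClosed T := hK.preimage p.continuous
  have hne : T.Nonempty := h
  have hmin : sInf T ∈ T := hT.csInf_mem hne (OrderBot.bddBelow _)
  set t₀ := sInf T
  have hlt : ∀ t, t < t₀ → p t ∉ K := fun t ht hm =>
    (csInf_le (OrderBot.bddBelow T) (show t ∈ T from hm)).not_gt ht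
  have hcomp : ∀ t, t < t₀ → p t ∈ connectedComponentIn Kᶜ x := by
    intro t ht
    have hpre : IsPreconnected (p '' Icc 0 t) := isPreconnected_Icc.image _ p.continuous.continuousOn
    refine hpre.subset_connectedComponentIn (x := x) ⟨0, ⟨le_rfl, t.2.1⟩, p.source⟩ ?_
      ⟨t, ⟨t.2.1, le_rfl⟩, rfl⟩
    rintro _ ⟨s, hs, rfl⟩
    exact hlt s (hs.2.trans_lt ht)
  refine ⟨p t₀, hmin, ?_⟩
  refine JoinedIn.ofLine (f := fun s => p.extend (s * t₀)) (by fun_prop) (by simp) (by simp) ?_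
  rintro _ ⟨s, hs, rfl⟩
  have hu : s * (t₀ : ℝ) ∈ unitInterval := unitInterval.mul_mem hs t₀.2
  have hle : (⟨s * t₀, hu⟩ : unitInterval) ≤ t₀ := mul_le_of_le_one_left t₀.2.1 hs.2
  simp only [Path.extend_apply p hu]
  refine ⟨⟨_, rfl⟩, ?_⟩
  rcases hle.lt_or_eq with h | h
  · exact Or.inr (hcomp _ h)
  · rw [h]
    exact Or.inl hmin

/-- A preconnected set that avoids `L` and meets the inside of `L` lies there together with its
own inside. -/
theorem insideSet_subset_of_subset {K L : Set ℂ} (hK : IsPreconnected K)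
    (hd : Disjoint K L) {x : ℂ} (hxK : x ∈ K) (hxL : x ∈ insideSet L) :
    K ∪ insideSet K ⊆ L ∪ insideSet L := by
  have hKL : K ⊆ insideSet L := subset_insideSet_of_isPreconnected hK hd hxK hxL
  refine union_subset (hKL.trans subset_union_right) fun z hz => ?_
  by_contra hcon
  simp only [mem_union, not_or] at hcon
  have hzL := hcon.1
  have hunb : ¬ Bornology.IsBounded (connectedComponentIn Lᶜ z) := fun h => hcon.2 ⟨hzL, h⟩
  refine hunb (hz.2.subset ?_)
  refine isPreconnected_connectedComponentIn.subset_connectedComponentIn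
    (mem_connectedComponentIn hzL) fun w hw hwK => ?_
  exact hcon.2 (mem_insideSet_of_mem (hKL hwK) (by
    rw [← connectedComponentIn_eq hw]; exact mem_connectedComponentIn hzL))

/-- Otherwise the component would be clopen, hence the whole plane, which is unbounded. -/
theorem nonempty_frontier_inter {K : Set ℂ} (hK : IsClosed K) {x : ℂ} (hx : x ∈ insideSet K) :
    ∃ y ∈ K, y ∈ closure (connectedComponentIn Kᶜ x) := by
  have hop : IsOpen (connectedComponentIn Kᶜ x) := hK.isOpen_compl.connectedComponentIn
  by_contra! hcon
  have hcl : IsClosed (connectedComponentIn Kᶜ x) := by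
    refine isClosed_of_closure_subset fun y hy => ?_
    exact (closure_connectedComponentIn_subset hK x hy).resolve_right fun h => hcon y h hy
  have huniv := IsClopen.eq_univ ⟨hcl, hop⟩ ⟨x, mem_connectedComponentIn hx.1⟩
  have hb := hx.2
  rw [huniv] at hb
  exact NoncompactSpace.noncompact_univ (X := ℂ)
    (Metric.isCompact_of_isClosed_isBounded isClosed_univ hb)

/-- If the filled versions of two disjoint closed connected sets meet, then they are nested. -/
theorem fill_subset_or_subset {K L : Set ℂ} (hKc : IsClosed K)
    (hK : IsPreconnected K) (hL : IsPreconnected L) (hd : Disjoint K L)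
    (hne : ((K ∪ insideSet K) ∩ (L ∪ insideSet L)).Nonempty) :
    K ∪ insideSet K ⊆ L ∪ insideSet L ∨ L ∪ insideSet L ⊆ K ∪ insideSet K := by
  obtain ⟨x, hxK, hxL⟩ := hne
  by_cases h1 : x ∈ K
  · exact Or.inl (insideSet_subset_of_subset hK hd h1
      (hxL.resolve_left (disjoint_left.1 hd h1)))
  by_cases h2 : x ∈ L
  · exact Or.inr (insideSet_subset_of_subset hL hd.symm h2 (hxK.resolve_left h1))
  have h3 := hxK.resolve_left h1
  have h4 := hxL.resolve_left h2
  -- Here `x` is inside both sets. If its component off `K` meets `L`, then `L` lies inside `K`. If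
  -- not, that component together with a boundary point `y ∈ K` is connected and avoids `L`, so `y`
  -- is inside `L`.
  by_cases h5 : (connectedComponentIn Kᶜ x ∩ L).Nonempty
  · obtain ⟨y, hy, hyL⟩ := h5
    exact Or.inr (insideSet_subset_of_subset hL hd.symm hyL (mem_insideSet_of_mem h3 hy))
  · obtain ⟨y, hyK, hy⟩ := nonempty_frontier_inter hKc h3
    have hpre : IsPreconnected (insert y (connectedComponentIn Kᶜ x)) :=
      isPreconnected_connectedComponentIn.subset_closure (subset_insert _ _)
        (insert_subset hy subset_closure)
    have hdis : Disjoint (insert y (connectedComponentIn Kᶜ x)) L :=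
      disjoint_left.2 fun w hw hwL => by
        rcases hw with rfl | hw
        · exact disjoint_left.1 hd hyK hwL
        · exact h5 ⟨w, hw, hwL⟩
    exact Or.inl (insideSet_subset_of_subset hK hd hyK
      (subset_insideSet_of_isPreconnected hpre hdis
        (mem_insert_of_mem _ (mem_connectedComponentIn h3.1)) h4 (mem_insert _ _)))

theorem fill_mono {K L : Set ℂ} (h : K ⊆ L) : K ∪ insideSet K ⊆ L ∪ insideSet L := by
  refine union_subset (h.trans subset_union_left) fun z hz => ?_
  by_cases hzL : z ∈ L
  · exact Or.inl hzL
  · exact Or.inr ⟨hzL, hz.2.subset (connectedComponentIn_mono _ (compl_subset_compl.2 h))⟩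

/-- A chain of connected compact sets whose filled versions overlap contains a connected set
whose filled version covers the whole chain. -/
theorem exists_isPathConnected_fill {l : ℕ → Set ℂ} (hl : ∀ i, IsPathConnected (l i))
    (hc : ∀ i, IsClosed (l i)) (n : ℕ)
    (hov : ∀ i < n, ((l i ∪ insideSet (l i)) ∩ (l (i + 1) ∪ insideSet (l (i + 1)))).Nonempty) :
    ∃ L, IsPathConnected L ∧ IsClosed L ∧ L ⊆ ⋃ i ∈ Finset.range (n + 1), l i ∧
      ∀ i ≤ n, l i ∪ insideSet (l i) ⊆ L ∪ insideSet L := by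
  induction n with
  | zero =>
    refine ⟨l 0, hl 0, hc 0, by simp, fun i hi => ?_⟩
    rw [Nat.le_zero.1 hi]
  | succ n ih =>
    obtain ⟨L, hL, hLc, hsub, hfill⟩ := ih fun i hi => hov i (by omega)
    have hsub' : L ⊆ ⋃ i ∈ Finset.range (n + 1 + 1), l i :=
      hsub.trans (biUnion_subset_biUnion_left fun i hi => by
        simp only [Finset.coe_range, mem_Iio] at hi ⊢
        omega)
    have hlsub : l (n + 1) ⊆ ⋃ i ∈ Finset.range (n + 1 + 1), l i :=
      subset_biUnion_of_mem (u := fun i => l i) (by simp)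
    have hle : ∀ i ≤ n + 1, i ≤ n ∨ i = n + 1 := fun i hi => by omega
    have hmeet : ((L ∪ insideSet L) ∩ (l (n + 1) ∪ insideSet (l (n + 1)))).Nonempty := by
      obtain ⟨x, hx, hx'⟩ := hov n (by omega)
      exact ⟨x, hfill n le_rfl hx, hx'⟩
    -- Disjoint sets have nested fillings, and the one with the larger filling is kept; intersecting
    -- sets have a connected union.
    by_cases hd : Disjoint L (l (n + 1))
    · rcases fill_subset_or_subset hLc hL.isConnected.isPreconnected
        (hl _).isConnected.isPreconnected hd hmeet with h | h
      · refine ⟨l (n + 1), hl _, hc _, hlsub, fun i hi => ?_⟩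
        rcases hle i hi with hi | rfl
        · exact (hfill i hi).trans h
        · exact le_rfl
      · refine ⟨L, hL, hLc, hsub', fun i hi => ?_⟩
        rcases hle i hi with hi | rfl
        · exact hfill i hi
        · exact h
    · refine ⟨L ∪ l (n + 1), hL.union (hl _) (not_disjoint_iff_nonempty_inter.1 hd),
        hLc.union (hc _), union_subset hsub' hlsub, fun i hi => ?_⟩
      rcases hle i hi with hi | rfl
      · exact (hfill i hi).trans (fill_mono subset_union_left)
      · exact fill_mono subset_union_right

end Components

/-! ### The two facts from the Jordan curve theorem. -/

section Jordan

/-- For fixed `z`, lift `u ↦ z - c u` to a logarithm along the arc and take the difference of its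
end values; this does not depend on the lift. Near `z₀` the lift changes by the principal logarithm
of `1 + (z - z₀)/(z₀ - c u)`, up to an additive constant, whence continuity in `z`. -/
theorem exists_log_sub_div {c : ℝ → ℂ} (hc : Continuous c) {s t : ℝ} (hst : s ≤ t) :
    ∃ g : ℂ → ℂ, ContinuousOn g (c '' Icc s t)ᶜ ∧
      ∀ z ∈ (c '' Icc s t)ᶜ, Complex.exp (g z) = (z - c s) / (z - c t) := by
  have hne : ∀ z ∈ (c '' Icc s t)ᶜ, ∀ u ∈ Icc s t, z - c u ≠ 0 := fun z hz u hu h =>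
    hz ⟨u, hu, (sub_eq_zero.1 h).symm⟩
  have hlog : ∀ z : ℂ, ∃ L : ℝ → ℂ, Continuous L ∧
      (z ∈ (c '' Icc s t)ᶜ → ∀ u ∈ Icc s t, Complex.exp (L u) = z - c u) := by
    intro z
    by_cases hz : z ∈ (c '' Icc s t)ᶜ
    · obtain ⟨L, hL, hL'⟩ := exists_log (X := ℝ) (h := fun u => z - c (projIcc s t hst u))
        (by fun_prop) (fun u => hne z hz _ (projIcc s t hst u).2)
      exact ⟨L, hL, fun _ u hu => by rw [hL', projIcc_of_mem hst hu]⟩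
    · exact ⟨0, continuous_zero, fun h => absurd h hz⟩
  choose L hL hL' using hlog
  refine ⟨fun z => L z s - L z t, ?_, fun z hz => ?_⟩
  swap
  · rw [Complex.exp_sub, hL' z hz s ⟨le_rfl, hst⟩, hL' z hz t ⟨hst, le_rfl⟩]
  have hK : IsClosed (c '' Icc s t) := (isCompact_Icc.image hc).isClosed
  intro z₀ hz₀
  apply ContinuousAt.continuousWithinAt
  obtain ⟨d, hd, hball⟩ := Metric.isOpen_iff.1 hK.isOpen_compl z₀ hz₀
  have hsmall : ∀ z ∈ Metric.ball z₀ d, ∀ u ∈ Icc s t, ‖(z - z₀) / (z₀ - c u)‖ < 1 := by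
    intro z hz u hu
    have h1 : d ≤ ‖z₀ - c u‖ := by
      by_contra hlt
      exact hball (mem_ball_iff_norm'.2 (not_le.1 hlt)) ⟨u, hu, rfl⟩
    rw [norm_div, div_lt_one (hd.trans_le h1)]
    exact (mem_ball_iff_norm.1 hz).trans_le h1
  have key : ∀ z ∈ Metric.ball z₀ d, L z s - L z t = L z₀ s - L z₀ t +
      (Complex.log (1 + (z - z₀) / (z₀ - c s)) - Complex.log (1 + (z - z₀) / (z₀ - c t))) := by
    intro z hz
    let G : ℝ → ℂ := fun u => L z₀ u + Complex.log (1 + (z - z₀) / (z₀ - c u))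
    have hG : ContinuousOn G (Icc s t) := by
      refine (hL z₀).continuousOn.add (ContinuousOn.clog ?_ fun u hu =>
        Complex.mem_slitPlane_of_norm_lt_one (hsmall z hz u hu))
      exact continuousOn_const.add (continuousOn_const.div (by fun_prop) (hne z₀ hz₀))
    have hexp : ∀ u ∈ Icc s t, Complex.exp (G u) = z - c u := fun u hu => by
      have h0 := hne z₀ hz₀ u hu
      rw [Complex.exp_add, hL' z₀ hz₀ u hu, Complex.exp_log
        (Complex.slitPlane_ne_zero (Complex.mem_slitPlane_of_norm_lt_one (hsmall z hz u hu)))]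
      field_simp
      ring
    have hs : s ∈ Icc s t := ⟨le_rfl, hst⟩
    have ht : t ∈ Icc s t := ⟨hst, le_rfl⟩
    have := eqOn_of_exp_eqOn (isPreconnected_Icc (a := s) (b := t))
      (f := fun u => L z u) (g := fun u => G u + (L z s - G s)) (hL z).continuousOn
      (hG.add continuousOn_const) (a := s) (fun u hu => by
        rw [Complex.exp_add, Complex.exp_sub, hexp u hu, hexp s hs, hL' z (hball hz) u hu,
          hL' z (hball hz) s hs, div_self (hne z (hball hz) s hs), mul_one]) hs (by simp) ht
    simp only [G] at this
    rw [this]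
    ring
  refine ContinuousAt.congr (f := fun z => L z₀ s - L z₀ t +
      (Complex.log (1 + (z - z₀) / (z₀ - c s)) - Complex.log (1 + (z - z₀) / (z₀ - c t)))) ?_
    (eventually_of_mem (Metric.ball_mem_nhds z₀ hd) fun z hz => (key z hz).symm)
  have hl : ∀ u, ContinuousAt (fun z => Complex.log (1 + (z - z₀) / (z₀ - c u))) z₀ := fun u =>
    ContinuousAt.clog (by fun_prop) (by simp)
  exact continuousAt_const.add ((hl s).sub (hl t))

/-- A closed curve that consists of two arcs with common endpoints separates the plane. -/
theorem not_isPreconnected_compl {c : ℝ → ℂ} (hc : Continuous c) {r s t : ℝ} (hrs : r ≤ s)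
    (hst : s ≤ t) (hclosed : c r = c t) (hne : c r ≠ c s)
    (hinter : ∀ u ∈ Icc r s, ∀ v ∈ Icc s t, c u = c v → c u = c r ∨ c u = c s) :
    ¬ IsPreconnected (c '' Icc r t)ᶜ := by
  intro hpre
  obtain ⟨g₁, hg₁, hg₁'⟩ := exists_log_sub_div hc hrs
  obtain ⟨g₂, hg₂, hg₂'⟩ := exists_log_sub_div hc hst
  have hcover : c '' Icc r t = c '' Icc r s ∪ c '' Icc s t := by
    rw [← image_union, Icc_union_Icc_eq_Icc hrs hst]
  set A := c '' Icc r s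
  set B := c '' Icc s t
  have hA : IsClosed A := (isCompact_Icc.image hc).isClosed
  have hB : IsClosed B := (isCompact_Icc.image hc).isClosed
  rw [hcover, compl_union] at hpre
  obtain ⟨w, hwA, hwB⟩ : (Aᶜ ∩ Bᶜ).Nonempty := by
    rw [← compl_union, ← hcover, nonempty_compl]
    intro h
    exact NoncompactSpace.noncompact_univ (X := ℂ) (h ▸ isCompact_Icc.image hc)
  have hAB : ∀ z, z ≠ c r → z ≠ c s → z ∈ Aᶜ ∪ Bᶜ := by
    intro z hr hs
    by_contra hcon
    simp only [mem_union, mem_compl_iff, not_or, not_not] at hcon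
    obtain ⟨⟨u, hu, rfl⟩, ⟨v, hv, huv⟩⟩ := hcon
    rcases hinter u hu v hv huv.symm with h | h <;> contradiction
  -- As `c r = c t`, the quotients that `g₁` and `g₂` are logarithms of have product `1`. So `g₁ +
  -- g₂` is constant on the complement, assumed connected.
  have heq : EqOn g₁ (fun z => (g₁ w + g₂ w) - g₂ z) (Aᶜ ∩ Bᶜ) := by
    refine eqOn_of_exp_eqOn hpre (hg₁.mono inter_subset_left)
      (continuousOn_const.sub (hg₂.mono inter_subset_right)) (fun z hz => ?_) ⟨hwA, hwB⟩ (by simp)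
    have e1 : ∀ z ∈ Aᶜ ∩ Bᶜ, z - c r ≠ 0 := fun z hz h =>
      hz.1 ⟨r, ⟨le_rfl, hrs⟩, (sub_eq_zero.1 h).symm⟩
    have e2 : ∀ z ∈ Aᶜ ∩ Bᶜ, z - c s ≠ 0 := fun z hz h =>
      hz.1 ⟨s, ⟨hrs, le_rfl⟩, (sub_eq_zero.1 h).symm⟩
    rw [Complex.exp_sub, Complex.exp_add, hg₁' z hz.1, hg₁' w hwA, hg₂' z hz.2, hg₂' w hwB,
      ← hclosed]
    have := e1 z hz
    have := e2 z hz
    have := e1 w ⟨hwA, hwB⟩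
    have := e2 w ⟨hwA, hwB⟩
    field_simp
  classical
  -- Glueing gives a logarithm of `(z - c r)/(z - c s)` on the plane minus these two points, since
  -- the arcs meet nowhere else.
  let G : ℂ → ℂ := fun z => if z ∈ A then (g₁ w + g₂ w) - g₂ z else g₁ z
  have hGA : EqOn G g₁ Aᶜ := fun z hz => if_neg hz
  have hGB : EqOn G (fun z => (g₁ w + g₂ w) - g₂ z) Bᶜ := fun z hz => by
    by_cases h : z ∈ A
    · exact if_pos h
    · rw [hGA h, heq ⟨h, hz⟩]
  have hG : ∀ z, z ≠ c r → z ≠ c s → ContinuousAt G z := by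
    intro z hr hs
    rcases hAB z hr hs with h | h
    · exact ((hg₁.congr hGA).continuousAt (hA.isOpen_compl.mem_nhds h))
    · exact (((continuousOn_const.sub hg₂).congr hGB).continuousAt (hB.isOpen_compl.mem_nhds h))
  have hGexp : ∀ z, z ≠ c r → z ≠ c s →
      Complex.exp (G z) = (z - c r) / (z - c s) := by
    intro z hr hs
    rcases hAB z hr hs with h | h
    · rw [hGA h, hg₁' z h]
    · rw [hGB h]
      have e1 := sub_ne_zero.2 hr
      have e2 := sub_ne_zero.2 hs
      have e3 : w - c r ≠ 0 := fun h => hwA ⟨r, ⟨le_rfl, hrs⟩, (sub_eq_zero.1 h).symm⟩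
      have e4 : w - c s ≠ 0 := fun h => hwA ⟨s, ⟨hrs, le_rfl⟩, (sub_eq_zero.1 h).symm⟩
      simp only [Complex.exp_sub, Complex.exp_add, hg₁' w hwA, hg₂' z h, hg₂' w hwB, ← hclosed]
      field_simp
  have hd : 0 < ‖c r - c s‖ := norm_pos_iff.2 (sub_ne_zero.2 hne)
  set d := ‖c r - c s‖
  have hsph : ∀ z ∈ Metric.sphere (c r) (d / 2), z ≠ c r ∧ z ≠ c s := by
    intro z hz
    rw [mem_sphere_iff_norm] at hz
    constructor
    · rintro rfl
      simp at hz
      linarith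
    · rintro rfl
      rw [norm_sub_rev] at hz
      change d = _ at hz
      linarith
  -- The circle about `c r` is small enough for `z - c s` to have a logarithm there; adding it to
  -- `G` yields an impossible logarithm of `z - c r`.
  refine not_exists_log_sphere (c r) (half_pos hd)
    (fun z => G z + Complex.log (1 + (z - c r) / (c r - c s)) + Complex.log (c r - c s)) ?_ ?_
  · have hlt : ∀ z ∈ Metric.sphere (c r) (d / 2), ‖(z - c r) / (c r - c s)‖ < 1 := fun z hz => by
      rw [norm_div, mem_sphere_iff_norm.1 hz, div_lt_one hd]
      exact half_lt_self hd
    refine ((ContinuousOn.add (fun z hz => (hG z (hsph z hz).1 (hsph z hz).2).continuousWithinAt)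
      (ContinuousOn.clog (by fun_prop) fun z hz =>
        Complex.mem_slitPlane_of_norm_lt_one (hlt z hz))).add continuousOn_const)
  · intro z hz
    have e2 := sub_ne_zero.2 (hsph z hz).2
    have e3 := sub_ne_zero.2 hne
    have e : 1 + (z - c r) / (c r - c s) = (z - c s) / (c r - c s) := by field_simp; ring
    rw [Complex.exp_add, Complex.exp_add, hGexp z (hsph z hz).1 (hsph z hz).2, e,
      Complex.exp_log (div_ne_zero e2 e3), Complex.exp_log e3]
    field_simp

/-- A simple loop, parametrized by an interval and started at any of its points. -/
theorem IsSimpleLoop.exists_param {γ : Curve} (h : IsSimpleLoop γ) {x : ℂ}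
    (hx : x ∈ (γ : Set ℂ)) :
    ∃ c : ℝ → ℂ, Continuous c ∧ c 0 = x ∧ c 1 = x ∧ InjOn c (Ico 0 1) ∧
      c '' Icc 0 1 = (γ : Set ℂ) := by
  obtain ⟨f, hf, hinj, hrange⟩ := h
  rw [← hrange] at hx
  obtain ⟨u, rfl⟩ := hx
  have hper : Circle.exp (2 * Real.pi * 1) = 1 := by simp
  refine ⟨fun t => f (u * Circle.exp (2 * Real.pi * t)), by fun_prop, by simp, by simp, ?_, ?_⟩
  · intro s hs t ht hst
    have h1 := mul_left_cancel (hinj hst)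
    have hpi := Real.pi_pos
    have : 2 * Real.pi * s = 2 * Real.pi * t := by
      obtain ⟨n, hn⟩ := Circle.exp_eq_exp.1 h1
      have h2 : s = t + n := by
        have : (2 * Real.pi) * s = (2 * Real.pi) * (t + n) := by linarith
        exact mul_left_cancel₀ (by positivity) this
      have h3 : (n : ℝ) < 1 := by linarith [hs.2, ht.1]
      have h4 : (-1 : ℝ) < n := by linarith [hs.1, ht.2]
      have h5 : n = 0 := by
        have : n < 1 := by exact_mod_cast h3
        have : -1 < n := by exact_mod_cast h4
        omega
      simp [h2, h5]
    exact mul_left_cancel₀ (by positivity) this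
  · rw [← hrange]
    apply Subset.antisymm
    · rintro _ ⟨t, -, rfl⟩
      exact ⟨_, rfl⟩
    · rintro _ ⟨v, rfl⟩
      obtain ⟨θ, hθ⟩ : ∃ θ : ℝ, Circle.exp θ = u⁻¹ * v := ⟨_, Circle.exp_arg _⟩
      have hpi := Real.two_pi_pos
      refine ⟨Int.fract (θ / (2 * Real.pi)), ⟨Int.fract_nonneg _, (Int.fract_lt_one _).le⟩, ?_⟩
      have : Circle.exp (2 * Real.pi * Int.fract (θ / (2 * Real.pi))) = Circle.exp θ := by
        rw [Circle.exp_eq_exp]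
        refine ⟨-⌊θ / (2 * Real.pi)⌋, ?_⟩
        rw [Int.fract]
        push_cast
        field_simp
        ring
      simp only [this, hθ, mul_inv_cancel_left]

/-- Existence of the bounded component in Jordan's theorem. -/
theorem IsSimpleLoop.nonempty_inside {γ : Curve} (h : IsSimpleLoop γ) : (inside γ).Nonempty := by
  obtain ⟨x, hx⟩ := γ.nonempty
  obtain ⟨c, hc, h0, h1, hinj, himg⟩ := h.exists_param hx
  have hsep := not_isPreconnected_compl hc (r := 0) (s := 1 / 2) (t := 1) (by norm_num)
    (by norm_num) (h0.trans h1.symm)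
    (fun h => by
      have := hinj (x₁ := 0) (x₂ := 1 / 2) (by norm_num) (by norm_num) h
      norm_num at this)
    (fun u hu v hv huv => by
      rcases hv.2.lt_or_eq with hv1 | rfl
      · have : u = v := hinj ⟨hu.1, by linarith [hu.2]⟩ ⟨by linarith [hv.1], hv1⟩ huv
        exact Or.inr (by rw [le_antisymm hu.2 (this ▸ hv.1)])
      · exact Or.inl (huv.trans (h1.trans h0.symm)))
  rw [himg] at hsep
  by_contra hempty
  rw [not_nonempty_iff_eq_empty, inside_eq_insideSet] at hempty
  obtain ⟨R, hR⟩ := γ.isCompact.isBounded.subset_ball 0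
  obtain ⟨w, hw⟩ : (Metric.ball (0 : ℂ) R)ᶜ.Nonempty := by
    rw [nonempty_iff_ne_empty]
    intro h
    exact not_isBounded_compl_ball 0 R (h ▸ Bornology.isBounded_empty)
  have hwγ : w ∈ (γ : Set ℂ)ᶜ := fun h => hw (hR h)
  refine hsep ?_
  -- If every component is unbounded, each one meets the connected complement of a large ball, so
  -- there is only one component.
  have : (γ : Set ℂ)ᶜ = connectedComponentIn (γ : Set ℂ)ᶜ w := by
    refine Subset.antisymm (fun z hz => ?_) (connectedComponentIn_subset _ _)
    have hunb : ¬ Bornology.IsBounded (connectedComponentIn (γ : Set ℂ)ᶜ z) := fun hb => by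
      have : z ∈ insideSet (γ : Set ℂ) := ⟨hz, hb⟩
      rw [hempty] at this
      exact this
    obtain ⟨y, hy, hyR⟩ : ∃ y ∈ connectedComponentIn (γ : Set ℂ)ᶜ z, y ∉ Metric.ball 0 R := by
      by_contra! hcon
      exact hunb (Metric.isBounded_ball.subset hcon)
    have h2 := (isPreconnected_compl_ball 0 R).subset_connectedComponentIn hw
      (compl_subset_compl.2 hR) hyR
    rw [connectedComponentIn_eq h2, ← connectedComponentIn_eq hy]
    exact mem_connectedComponentIn hz
  rw [this]
  exact isPreconnected_connectedComponentIn

/-- Every point of a simple loop lies on the boundary of each bounded component of the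
complement. -/
theorem IsSimpleLoop.subset_closure {γ : Curve} (h : IsSimpleLoop γ) {z : ℂ}
    (hz : z ∈ inside γ) : (γ : Set ℂ) ⊆ closure (connectedComponentIn (γ : Set ℂ)ᶜ z) := by
  intro x hx
  by_contra hcon
  obtain ⟨c, hc, h0, h1, hinj, himg⟩ := h.exists_param hx
  have hγ : IsClosed (γ : Set ℂ) := γ.isCompact.isClosed
  set V := connectedComponentIn (γ : Set ℂ)ᶜ z
  have hVo : IsOpen V := hγ.isOpen_compl.connectedComponentIn
  have hzV : z ∈ V := mem_connectedComponentIn hz.1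
  have hfr : frontier V ⊆ (γ : Set ℂ) := fun y hy =>
    (closure_connectedComponentIn_subset hγ z hy.1).resolve_left fun h =>
      hy.2 (hVo.interior_eq.symm ▸ h)
  have hopen : IsOpen (c ⁻¹' (closure V)ᶜ) := isClosed_closure.isOpen_compl.preimage hc
  obtain ⟨δ₀, hδ₀, hball₀⟩ := Metric.isOpen_iff.1 hopen 0 (by
    rwa [mem_preimage, h0])
  obtain ⟨δ₁, hδ₁, hball₁⟩ := Metric.isOpen_iff.1 hopen 1 (by
    rwa [mem_preimage, h1])
  let δ := min (min δ₀ δ₁) (1 / 2) / 2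
  have hδ : 0 < δ := by positivity
  have hd0 : δ < δ₀ := (half_lt_self (by positivity)).trans_le
    ((min_le_left _ _).trans (min_le_left _ _))
  have hd1 : δ < δ₁ := (half_lt_self (by positivity)).trans_le
    ((min_le_left _ _).trans (min_le_right _ _))
  have hdh : δ < 1 / 2 := (half_lt_self (by positivity)).trans_le (min_le_right _ _)
  have hle : δ ≤ 1 - δ := by linarith
  -- A neighbourhood of `x` misses the closure of `V`, so the frontier of `V` is confined to a
  -- proper arc, on which `w - z` has a logarithm. Tietze extends this logarithm to the plane.
  have harc : frontier V ⊆ c '' Icc δ (1 - δ) := by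
    intro y hy
    obtain ⟨t, ht, rfl⟩ : y ∈ c '' Icc 0 1 := himg ▸ hfr hy
    refine ⟨t, ⟨?_, ?_⟩, rfl⟩
    · by_contra hlt
      exact hball₀ (by
        rw [Metric.mem_ball, Real.dist_eq, sub_zero, abs_of_nonneg ht.1]; linarith) hy.1
    · by_contra hlt
      exact hball₁ (by
        rw [Metric.mem_ball, Real.dist_eq, abs_sub_comm, abs_of_nonneg (by linarith [ht.2])]
        linarith) hy.1
  let e : Icc δ (1 - δ) → ℂ := fun t => c t
  have he : IsClosedEmbedding e := (by fun_prop : Continuous e).isClosedEmbedding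
    fun s t hst => Subtype.ext (hinj ⟨by linarith [s.2.1], by linarith [s.2.2]⟩
      ⟨by linarith [t.2.1], by linarith [t.2.2]⟩ hst)
  have hzγ : ∀ t ∈ Icc δ (1 - δ), c t - z ≠ 0 := fun t ht heq => hz.1 (by
    rw [← sub_eq_zero.1 heq, ← himg]
    exact ⟨t, ⟨by linarith [ht.1], by linarith [ht.2]⟩, rfl⟩)
  obtain ⟨L, hL, hL'⟩ := exists_log (X := ℝ) (h := fun u => c (projIcc δ (1 - δ) hle u) - z)
    (by fun_prop) (fun u => hzγ _ (projIcc δ (1 - δ) hle u).2)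
  obtain ⟨g, hg⟩ := ContinuousMap.exists_extension he ⟨fun t : Icc δ (1 - δ) => L t, by fun_prop⟩
  have hg' : ∀ t ∈ Icc δ (1 - δ), Complex.exp (g (c t)) = c t - z := fun t ht => by
    have := DFunLike.congr_fun hg ⟨t, ht⟩
    simp only [ContinuousMap.comp_apply, ContinuousMap.coe_mk, e] at this
    rw [this, hL', projIcc_of_mem hle ht]
  classical
  -- This replaces `w - z` on the closure of `V` by a function without zeros. The result is
  -- continuous and nonvanishing on the whole plane, so it has a logarithm, yet it equals `w - z` on
  -- a large circle.
  let F : ℂ → ℂ := fun w => if w ∈ closure V then Complex.exp (g w) else w - z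
  have hF : Continuous F := by
    refine Continuous.if (fun w hw => ?_) (by fun_prop) (by fun_prop)
    obtain ⟨t, ht, rfl⟩ := harc (frontier_closure_subset hw)
    exact hg' t ht
  have hF0 : ∀ w, F w ≠ 0 := fun w => by
    by_cases hw : w ∈ closure V
    · simp [F, hw, Complex.exp_ne_zero]
    · simp only [F, hw, if_false]
      exact fun heq => hw (sub_eq_zero.1 heq ▸ _root_.subset_closure hzV)
  obtain ⟨k, hk, hk'⟩ := exists_log hF hF0
  have hVb : Bornology.IsBounded V := hz.2
  obtain ⟨R, hR⟩ := hVb.closure.subset_ball z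
  refine not_exists_log_sphere z (r := max R 1) (by positivity) k hk.continuousOn fun w hw => ?_
  have hw' : w ∉ closure V := fun hmem => by
    have h2 := hR hmem
    rw [Metric.mem_sphere] at hw
    rw [Metric.mem_ball, hw] at h2
    exact (le_max_left R 1).not_gt h2
  rw [hk']
  simp [F, hw']

end Jordan

/-! ### Capacitability and universal measurability of analytic sets. -/

section Analytic

instance instPolishSpaceBool : PolishSpace Bool := by
  have : SecondCountableTopology Bool := inferInstance
  infer_instance

/-- Capacitability of analytic sets. -/
theorem exists_isCompact_of_analyticSet {X : Type*} [TopologicalSpace X] [MeasurableSpace X]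
    {ν : Measure X} [ν.OuterRegular] {A : Set X} (hA : AnalyticSet A) {r : ℝ≥0∞} (hr : r < ν A) :
    ∃ K ⊆ A, IsCompact K ∧ r ≤ ν K := by
  rw [AnalyticSet] at hA
  rcases hA with rfl | ⟨f, hf, rfl⟩
  · simp at hr
  -- Bounding one more coordinate loses arbitrarily little: outer measure is continuous along
  -- increasing unions, even of nonmeasurable sets.
  have hstep : ∀ (S : Set (ℕ → ℕ)) (k : ℕ), r < ν (f '' S) →
      ∃ m, r < ν (f '' (S ∩ {x | x k ≤ m})) := by
    intro S k hS
    have hU : f '' S = ⋃ m, f '' (S ∩ {x | x k ≤ m}) := by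
      rw [← image_iUnion, ← inter_iUnion]
      congr 1
      refine (inter_eq_left.2 fun x _ => mem_iUnion.2 ⟨x k, by simp⟩).symm
    have hmono : Monotone fun m => f '' (S ∩ {x | x k ≤ m}) := fun m m' h =>
      image_mono (inter_subset_inter_right _ fun x hx => le_trans hx h)
    rw [hU, hmono.measure_iUnion, lt_iSup_iff] at hS
    exact hS
  choose! b hb using hstep
  let s : ℕ → Set (ℕ → ℕ) := fun k => Nat.rec univ (fun k S => S ∩ {x | x k ≤ b S k}) k
  have hs_succ : ∀ k, s (k + 1) = s k ∩ {x | x k ≤ b (s k) k} := fun k => rfl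
  have hs : ∀ k, r < ν (f '' s k) := by
    intro k
    induction k with
    | zero => simpa [s] using hr
    | succ k ih => exact hb _ _ ih
  let m : ℕ → ℕ := fun k => b (s k) k
  have hmem : ∀ k x, x ∈ s k ↔ ∀ i < k, x i ≤ m i := by
    intro k x
    induction k with
    | zero => simp [s]
    | succ k ih =>
      rw [hs_succ, mem_inter_iff, ih, Nat.forall_lt_succ_right]
      rfl
  let p : Set (ℕ → ℕ) := univ.pi fun i => Iic (m i)
  have hp : IsCompact p := isCompact_univ_pi fun i => (finite_Iic (m i)).isCompact
  refine ⟨f '' p, image_subset_range _ _, hp.image hf, ?_⟩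
  by_contra! hlt
  obtain ⟨U, hpU, hU, hUr⟩ := Set.exists_isOpen_lt_of_lt _ _ hlt
  have hcyl : ∀ x ∈ p, ∃ n, PiNat.cylinder x n ⊆ f ⁻¹' U := by
    intro x hx
    obtain ⟨_, ⟨y, n, rfl⟩, hxn, hsub⟩ :=
      (PiNat.isTopologicalBasis_cylinders fun _ : ℕ => ℕ).exists_subset_of_mem_open
        (show x ∈ f ⁻¹' U from hpU ⟨x, hx, rfl⟩) (hU.preimage hf)
    refine ⟨n, ?_⟩
    rwa [PiNat.mem_cylinder_iff_eq.1 hxn]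
  choose! n hn using hcyl
  obtain ⟨t, htp, ht⟩ := hp.elim_nhds_subcover (fun x => PiNat.cylinder x (n x)) fun x _ =>
    (PiNat.isOpen_cylinder _ x (n x)).mem_nhds (PiNat.self_mem_cylinder x _)
  let k := t.sup n
  have hsub : f '' s k ⊆ U := by
    rintro _ ⟨x, hx, rfl⟩
    -- Truncation sends `x` into `p` without changing its first `k` coordinates, and only these
    -- matter for the chosen cylinders.
    have hy : (fun i => min (x i) (m i)) ∈ p := fun i _ => by simp
    obtain ⟨z, hz, hyz⟩ := mem_iUnion₂.1 (ht hy)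
    refine hn z (htp z hz) fun i hi => ?_
    rw [← hyz i hi]
    exact (min_eq_left ((hmem k x).1 hx i (hi.trans_le (Finset.le_sup hz)))).symm
  exact ((hs k).trans_le (measure_mono hsub)).not_gt hUr

/-- Analytic sets are universally measurable. -/
theorem nullMeasurableSet_of_analyticSet {X : Type*} [TopologicalSpace X] [T2Space X]
    [MeasurableSpace X] [OpensMeasurableSpace X] {ν : Measure X} [IsFiniteMeasure ν]
    [ν.OuterRegular] {A : Set X} (hA : AnalyticSet A) : NullMeasurableSet A ν := by
  by_cases h0 : ν A = 0
  · exact NullMeasurableSet.of_null h0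
  obtain ⟨u, -, hu, hlim⟩ := exists_seq_strictMono_tendsto' (pos_iff_ne_zero.2 h0)
  choose K hKA hK hKu using fun n => exists_isCompact_of_analyticSet hA (hu n).2
  have hm : MeasurableSet (⋃ n, K n) := .iUnion fun n => (hK n).measurableSet
  have hle : ν A ≤ ν (⋃ n, K n) :=
    le_of_tendsto' hlim fun n => (hKu n).trans (measure_mono (subset_iUnion K n))
  have hsub : (⋃ n, K n) ⊆ A := iUnion_subset hKA
  refine hm.nullMeasurableSet.congr ?_
  exact ae_eq_of_subset_of_measure_ge hsub hle hm.nullMeasurableSet (measure_ne_top _ _)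

end Analytic

/-! ### Poisson processes seen through vacancy indicators. -/

section Poisson

variable {E : Type*}

open Classical in
/-- The vacancy indicators of a configuration `C` for a family of sets. -/
noncomputable def vacancy {ι : Type*} (S : ι → Set E) (C : Set E) (i : ι) : Bool :=
  decide (C ∩ S i = ∅)

theorem vacancy_eq_true {ι : Type*} {S : ι → Set E} {C : Set E} {i : ι} :
    vacancy S C i = true ↔ C ∩ S i = ∅ := by simp [vacancy]

theorem vacancy_eq_false {ι : Type*} {S : ι → Set E} {C : Set E} {i : ι} :
    vacancy S C i = false ↔ (C ∩ S i).Nonempty := by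
  simp [vacancy, nonempty_iff_ne_empty]

theorem vacancy_inter {ι : Type*} (S : ι → Set E) (C U : Set E) :
    vacancy S (C ∩ U) = vacancy (fun i => U ∩ S i) C := by
  funext i
  simp only [vacancy, inter_assoc]

theorem vacancy_image {ι : Type*} (S : ι → Set E) (T : E → E) (C : Set E) :
    vacancy S (T '' C) = vacancy (fun i => T ⁻¹' S i) C := by
  funext i
  rw [Bool.eq_iff_iff, vacancy_eq_true, vacancy_eq_true, ← image_inter_preimage, image_eq_empty]

/-- The probability that a Poisson variable vanishes. -/
noncomputable def voidProb (x : ℝ≥0∞) : ℝ≥0∞ :=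
  if x = ∞ then 0 else ENNReal.ofReal (Real.exp (-x.toReal))

/-- Joint vacancy of finitely many sets is vacancy of their union. As these cylinders form a
generating π-system, void probabilities determine the law of the indicators. -/
theorem vacancy_preimage_trueCylinder {Ω ι : Type*} (S : ι → Set E) (Γ : Ω → Set E) (F : Finset ι) :
    (fun ω => vacancy S (Γ ω)) ⁻¹' {n | ∀ i ∈ F, n i = true} =
      {ω | Γ ω ∩ (⋃ i ∈ F, S i) = ∅} := by
  ext ω
  simp [vacancy_eq_true, inter_iUnion]

variable [MeasurableSpace E] {Ω : Type*} [MeasurableSpace Ω] {P : Measure Ω}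
  {Γ : Ω → Set E} {μ : Measure E}

theorem IsPoissonPointProcess.measure_void [IsProbabilityMeasure P]
    (hΓ : IsPoissonPointProcess P Γ μ) {A : Set E} (hA : MeasurableSet A) :
    P {ω | Γ ω ∩ A = ∅} = voidProb (μ A) := by
  have h0 : {ω | Γ ω ∩ A = ∅} = {ω | (Γ ω ∩ A).encard = (0 : ℕ)} := by simp
  unfold voidProb
  split_ifs with h
  · refine measure_mono_null ?_ (hΓ.count_infinite A hA h)
    intro ω hω htop
    simp only [mem_ofPred_eq] at hω htop
    simp [hω] at htop
  · rw [h0, hΓ.count_poisson A hA h, poissonMeasure_singleton]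
    simp [ENNReal.coe_toNNReal_eq_toReal]

theorem IsPoissonPointProcess.measurable_vacancy (hΓ : IsPoissonPointProcess P Γ μ) {ι : Type*}
    {S : ι → Set E} (hS : ∀ i, MeasurableSet (S i)) :
    Measurable fun ω => vacancy S (Γ ω) := by
  refine measurable_pi_lambda _ fun i => measurable_to_bool ?_
  have : (fun ω => vacancy S (Γ ω) i) ⁻¹' {true} =
      (fun ω => (Γ ω ∩ S i).encard) ⁻¹' {0} := by
    ext ω
    simp [vacancy_eq_true]
  rw [this]
  exact hΓ.measurable_count _ (hS i) (measurableSet_singleton _)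

section Cylinders

variable {ι : Type*}

/-- The sets of boolean families that are true on a given finite set. -/
def trueCylinders (ι : Type*) : Set (Set (ι → Bool)) :=
  range fun F : Finset ι => {n | ∀ i ∈ F, n i = true}

theorem isPiSystem_trueCylinders : IsPiSystem (trueCylinders ι) := by
  classical
  rintro _ ⟨F, rfl⟩ _ ⟨G, rfl⟩ -
  refine ⟨F ∪ G, ?_⟩
  ext n
  simp only [Finset.mem_union, mem_ofPred_eq, mem_inter_iff]
  exact ⟨fun h => ⟨fun i hi => h i (Or.inl hi), fun i hi => h i (Or.inr hi)⟩,
    fun h i hi => hi.elim (h.1 i) (h.2 i)⟩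

theorem measurableSet_of_mem_trueCylinders {s : Set (ι → Bool)} (hs : s ∈ trueCylinders ι) :
    MeasurableSet s := by
  obtain ⟨F, rfl⟩ := hs
  have : {n : ι → Bool | ∀ i ∈ F, n i = true} = ⋂ i ∈ F, (fun n => n i) ⁻¹' {true} := by
    ext; simp
  simp only [this]
  exact F.measurableSet_biInter fun i _ => measurable_pi_apply i (measurableSet_singleton _)

theorem generateFrom_trueCylinders :
    (MeasurableSpace.pi : MeasurableSpace (ι → Bool)) =
      MeasurableSpace.generateFrom (trueCylinders ι) := by
  apply le_antisymm
  · refine iSup_le fun i => ?_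
    have : Measurable[MeasurableSpace.generateFrom (trueCylinders ι)]
        fun n : ι → Bool => n i := by
      refine measurable_to_bool (MeasurableSpace.measurableSet_generateFrom ⟨{i}, ?_⟩)
      ext; simp
    exact this.comap_le
  · exact MeasurableSpace.generateFrom_le fun _ => measurableSet_of_mem_trueCylinders

end Cylinders

/-- The joint law of the vacancy indicators only depends on the intensities of finite unions. -/
theorem IsPoissonPointProcess.map_vacancy_congr [IsProbabilityMeasure P]
    (hΓ : IsPoissonPointProcess P Γ μ) {ι : Type*} {S S' : ι → Set E}
    (hS : ∀ i, MeasurableSet (S i)) (hS' : ∀ i, MeasurableSet (S' i))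
    (h : ∀ F : Finset ι, μ (⋃ i ∈ F, S i) = μ (⋃ i ∈ F, S' i)) :
    P.map (fun ω => vacancy S (Γ ω)) = P.map (fun ω => vacancy S' (Γ ω)) := by
  have hm := hΓ.measurable_vacancy hS
  have hm' := hΓ.measurable_vacancy hS'
  have := Measure.isProbabilityMeasure_map (μ := P) hm.aemeasurable
  have := Measure.isProbabilityMeasure_map (μ := P) hm'.aemeasurable
  refine ext_of_generate_finite _ generateFrom_trueCylinders isPiSystem_trueCylinders ?_ (by simp)
  intro s hs
  have hsm := measurableSet_of_mem_trueCylinders hs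
  obtain ⟨F, rfl⟩ := hs
  rw [Measure.map_apply hm hsm, Measure.map_apply hm' hsm, vacancy_preimage_trueCylinder,
    vacancy_preimage_trueCylinder, hΓ.measure_void (F.measurableSet_biUnion fun i _ => hS i),
    hΓ.measure_void (F.measurableSet_biUnion fun i _ => hS' i), h F]

theorem IsPoissonPointProcess.indepFun_vacancy [IsProbabilityMeasure P]
    (hΓ : IsPoissonPointProcess P Γ μ) {ι ι' : Type*} {S : ι → Set E} {S' : ι' → Set E}
    (hS : ∀ i, MeasurableSet (S i)) (hS' : ∀ i, MeasurableSet (S' i))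
    (h : ∀ i j, Disjoint (S i) (S' j)) :
    IndepFun (fun ω => vacancy S (Γ ω)) (fun ω => vacancy S' (Γ ω)) P := by
  have hm := hΓ.measurable_vacancy hS
  have hm' := hΓ.measurable_vacancy hS'
  rw [IndepFun_iff_Indep, generateFrom_trueCylinders (ι := ι),
    generateFrom_trueCylinders (ι := ι'), MeasurableSpace.comap_generateFrom,
    MeasurableSpace.comap_generateFrom]
  refine IndepSets.indep' ?_ ?_ (isPiSystem_trueCylinders.comap _)
    (isPiSystem_trueCylinders.comap _) ?_
  · rintro _ ⟨s, hs, rfl⟩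
    exact hm (measurableSet_of_mem_trueCylinders hs)
  · rintro _ ⟨s, hs, rfl⟩
    exact hm' (measurableSet_of_mem_trueCylinders hs)
  rw [IndepSets_iff]
  rintro _ _ ⟨_, ⟨F, rfl⟩, rfl⟩ ⟨_, ⟨G, rfl⟩, rfl⟩
  rw [vacancy_preimage_trueCylinder, vacancy_preimage_trueCylinder]
  have hF := F.measurableSet_biUnion fun i _ => hS i
  have hG := G.measurableSet_biUnion fun i _ => hS' i
  have hdis : Disjoint (⋃ i ∈ F, S i) (⋃ i ∈ G, S' i) := by
    simp only [disjoint_iUnion_left, disjoint_iUnion_right]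
    exact fun i _ j _ => h j i
  have hind := hΓ.count_indep 2 ![⋃ i ∈ F, S i, ⋃ i ∈ G, S' i]
    (by simp [Fin.forall_fin_two, hF, hG])
    (by
      intro i j hij
      fin_cases i <;> fin_cases j <;> first | exact absurd rfl hij | exact hdis | exact hdis.symm)
  have := (hind.indepFun (i := 0) (j := 1) (by decide)).measure_inter_preimage_eq_mul {0} {0}
    (measurableSet_singleton _) (measurableSet_singleton _)
  convert this using 2
  · ext ω; simp
  · congr 1; ext ω; simp
  · congr 1; ext ω; simp

/-! ### Harris' inequality: finite, compact, then analytic events. -/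

section Harris

/-- Harris' inequality for finitely many independent boolean variables. -/
theorem harris_finite [IsProbabilityMeasure P] {κ : Type*} [Fintype κ] {X : κ → Ω → Bool}
    (hX : iIndepFun X P) (hXm : ∀ a, Measurable (X a)) {A B : Set (κ → Bool)}
    (hA : IsUpperSet A) (hB : IsUpperSet B) :
    P {ω | (fun a => X a ω) ∈ A} * P {ω | (fun a => X a ω) ∈ B} ≤
      P {ω | (fun a => X a ω) ∈ A ∩ B} := by
  classical
  let Y : Ω → κ → Bool := fun ω a => X a ω
  have hY : Measurable Y := measurable_pi_lambda _ hXm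
  let w : (κ → Bool) → ℝ := fun m => ∏ a, P.real (X a ⁻¹' {m a})
  have hw : ∀ m, P.real (Y ⁻¹' {m}) = w m := by
    intro m
    have := hX.measure_inter_preimage_eq_mul Finset.univ (sets := fun a => {m a})
      fun a _ => measurableSet_singleton _
    simp only [measureReal_def, w]
    rw [← ENNReal.toReal_prod, ← this]
    congr 2
    ext ω
    simp [Y, funext_iff]
  have hsum : ∀ C : Set (κ → Bool), P.real (Y ⁻¹' C) = ∑ m, w m * C.indicator 1 m := by
    intro C
    have hC : Y ⁻¹' C = ⋃ m ∈ Finset.univ.filter (· ∈ C), Y ⁻¹' {m} := by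
      ext ω; simp
    rw [hC, measureReal_biUnion_finset ?_ fun m _ => hY (measurableSet_singleton _),
      Finset.sum_filter]
    · refine Finset.sum_congr rfl fun m _ => ?_
      by_cases h : m ∈ C <;> simp [h, hw]
    · intro m _ m' _ hne
      exact Disjoint.preimage _ (disjoint_singleton.2 hne)
  have hmono : ∀ {C : Set (κ → Bool)}, IsUpperSet C →
      Monotone (C.indicator (1 : (κ → Bool) → ℝ)) := by
    intro C hC m m' hmm
    by_cases h : m ∈ C
    · simp [h, hC hmm h]
    · simp only [indicator_of_notMem h]
      exact indicator_nonneg (fun _ _ => zero_le_one) _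
  -- For a product weight the FKG lattice condition holds with equality.
  have key := fkg (μ := w) (f := A.indicator 1) (g := B.indicator 1)
    (fun m => Finset.prod_nonneg fun _ _ => measureReal_nonneg)
    (indicator_nonneg fun _ _ => zero_le_one) (indicator_nonneg fun _ _ => zero_le_one)
    (hmono hA) (hmono hB) (fun m m' => by
      simp only [w, ← Finset.prod_mul_distrib]
      refine le_of_eq (Finset.prod_congr rfl fun a _ => ?_)
      cases h : m a <;> cases h' : m' a <;> simp [h, h', mul_comm])
  have h1 : ∑ m, w m = 1 := by
    have := hsum univ
    simpa using this.symm
  have hAB : ∀ m, A.indicator (1 : (κ → Bool) → ℝ) m * B.indicator 1 m =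
      (A ∩ B).indicator 1 m := fun m => by
    rw [inter_indicator_one]; rfl
  simp only [hAB] at key
  rw [h1, one_mul, ← hsum, ← hsum, ← hsum] at key
  have := ENNReal.ofReal_le_ofReal key
  rwa [ENNReal.ofReal_mul measureReal_nonneg, ofReal_measureReal, ofReal_measureReal,
    ofReal_measureReal] at this

/-- Harris' inequality for the vacancy indicators of finitely many sets. -/
theorem IsPoissonPointProcess.harris_fintype [IsProbabilityMeasure P]
    (hΓ : IsPoissonPointProcess P Γ μ) {κ : Type*} [Fintype κ] {S : κ → Set E}
    (hS : ∀ i, MeasurableSet (S i)) {A B : Set (κ → Bool)}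
    (hA : IsUpperSet A) (hB : IsUpperSet B) :
    P {ω | vacancy S (Γ ω) ∈ A} * P {ω | vacancy S (Γ ω) ∈ B} ≤
      P {ω | vacancy S (Γ ω) ∈ A ∩ B} := by
  classical
  -- The atoms of the algebra generated by the `S i`: they are disjoint, so their occupation numbers
  -- are independent.
  let T : (κ → Bool) → Set E := fun a => {x | ∀ i, x ∈ S i ↔ a i = true}
  have hT : ∀ a, MeasurableSet (T a) := by
    intro a
    have : T a = ⋂ i, if a i = true then S i else (S i)ᶜ := by
      ext x
      simp only [T, mem_ofPred_eq, mem_iInter]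
      refine forall_congr' fun i => ?_
      by_cases h : a i = true <;> simp [h]
    rw [this]
    refine .iInter fun i => ?_
    split_ifs
    exacts [hS i, (hS i).compl]
  have hTd : Pairwise fun a b => Disjoint (T a) (T b) := by
    intro a b hab
    refine disjoint_left.2 fun x ha hb => hab (funext fun i => ?_)
    simp only [T, mem_ofPred_eq] at ha hb
    exact Bool.eq_iff_iff.2 ((ha i).symm.trans (hb i))
  -- `S i` is vacant iff every atom contained in it is vacant, and this is monotone in the atoms'
  -- indicators.
  let φ : ((κ → Bool) → Bool) → κ → Bool := fun m i => decide (∀ a, a i = true → m a = true)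
  have hφ : Monotone φ := by
    intro m m' h i
    rw [Bool.le_iff_imp]
    simp only [φ, decide_eq_true_eq]
    exact fun h' a ha => Bool.le_iff_imp.1 (h a) (h' a ha)
  have hvac : ∀ C, vacancy S C = φ (vacancy T C) := by
    intro C
    ext i
    rw [Bool.eq_iff_iff]
    simp only [φ, decide_eq_true_eq, vacancy_eq_true, eq_empty_iff_forall_notMem, mem_inter_iff,
      not_and]
    constructor
    · intro h a ha x hx hxa
      exact h x hx ((hxa i).2 ha)
    · intro h x hx hxi
      exact h (fun j => decide (x ∈ S j)) (by simpa using hxi) x hx fun j => by simp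
  have hX : iIndepFun (fun a ω => vacancy T (Γ ω) a) P := by
    have e := Fintype.equivFin (κ → Bool)
    have h1 := hΓ.count_indep _ (fun n => T (e.symm n)) (fun n => hT _)
      fun i j hij => hTd (e.symm.injective.ne hij)
    have h2 := (h1.precomp e.injective).comp (fun _ n => decide (n = 0))
      fun _ => .of_discrete
    convert h2 using 3 with a
    simp [vacancy]
  simp only [hvac]
  exact harris_finite hX (fun a => (measurable_pi_apply a).comp (hΓ.measurable_vacancy hT))
    (hA.preimage hφ) (hB.preimage hφ)

/-- A compact set is the decreasing intersection of its cylinder hulls over finite sets of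
coordinates. The hulls of an upper set are again upper, so the finite case passes to the limit. -/
theorem IsPoissonPointProcess.harris_isCompact [IsProbabilityMeasure P]
    (hΓ : IsPoissonPointProcess P Γ μ) {ι : Type*} [Countable ι] {S : ι → Set E}
    (hS : ∀ i, MeasurableSet (S i)) {A B : Set (ι → Bool)}
    (hA : IsUpperSet A) (hB : IsUpperSet B) (hAc : IsCompact A) (hBc : IsCompact B) :
    P {ω | vacancy S (Γ ω) ∈ A} * P {ω | vacancy S (Γ ω) ∈ B} ≤
      P {ω | vacancy S (Γ ω) ∈ A ∩ B} := by
  classical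
  let c : Finset ι → Set (ι → Bool) → Set (ι → Bool) := fun F K =>
    {n | ∃ k ∈ K, ∀ i ∈ F, k i = n i}
  have hsub : ∀ F K, K ⊆ c F K := fun F K n hn => ⟨n, hn, fun _ _ => rfl⟩
  have hanti : ∀ K, Antitone fun F => c F K := fun K F G h n ⟨k, hk, hkn⟩ =>
    ⟨k, hk, fun i hi => hkn i (h hi)⟩
  have hInter : ∀ K, IsCompact K → ⋂ F, c F K = K := by
    intro K hK
    refine Subset.antisymm (fun n hn => ?_) (subset_iInter fun F => hsub F K)
    rw [← hK.isClosed.closure_eq, mem_closure_iff]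
    intro U hU hnU
    obtain ⟨F, u, hu, huU⟩ := isOpen_pi_iff.1 hU n hnU
    obtain ⟨k, hk, hkn⟩ := mem_iInter.1 hn F
    exact ⟨k, huU fun i hi => hkn i hi ▸ (hu i hi).2, hk⟩
  have hfin : ∀ (F : Finset ι) K, ∃ D : Set (F → Bool), (IsUpperSet K → IsUpperSet D) ∧
      ∀ C, vacancy S C ∈ c F K ↔ vacancy (fun i : F => S i) C ∈ D := by
    intro F K
    refine ⟨{m | ∃ k ∈ K, ∀ i : F, k i = m i}, fun hK m m' hmm => ?_, fun C => ?_⟩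
    · rintro ⟨k, hk, hkm⟩
      refine ⟨fun i => if h : i ∈ F then m' ⟨i, h⟩ else k i, hK (fun i => ?_) hk, fun i => by simp⟩
      by_cases h : i ∈ F
      · simp only [h, dite_true]
        exact (hkm ⟨i, h⟩).trans_le (hmm ⟨i, h⟩)
      · simp [h]
    · simp only [c, mem_ofPred_eq, Subtype.forall]
      rfl
  have hmc : ∀ F K, MeasurableSet {ω | vacancy S (Γ ω) ∈ c F K} := by
    intro F K
    obtain ⟨D, -, hD⟩ := hfin F K
    simp only [hD]
    exact hΓ.measurable_vacancy (fun i : F => hS i) (toFinite D).measurableSet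
  have hlim : Tendsto (fun F => P {ω | vacancy S (Γ ω) ∈ c F A ∩ c F B}) atTop
      (𝓝 (P {ω | vacancy S (Γ ω) ∈ A ∩ B})) := by
    have hset : {ω | vacancy S (Γ ω) ∈ A ∩ B} =
        ⋂ F, {ω | vacancy S (Γ ω) ∈ c F A ∩ c F B} := by
      conv_lhs => rw [← hInter A hAc, ← hInter B hBc, ← iInter_inter_distrib]
      ext ω
      simp only [mem_ofPred_eq, mem_iInter]
    rw [hset]
    exact tendsto_measure_iInter_atTop (μ := P)
      (s := fun F => {ω | vacancy S (Γ ω) ∈ c F A ∩ c F B})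
      (fun F => ((hmc F A).inter (hmc F B)).nullMeasurableSet)
      (fun F G h ω hω => ⟨hanti A h hω.1, hanti B h hω.2⟩) ⟨∅, measure_ne_top _ _⟩
  refine ge_of_tendsto' hlim fun F => ?_
  obtain ⟨D, hDu, hD⟩ := hfin F A
  obtain ⟨D', hDu', hD'⟩ := hfin F B
  calc _ ≤ P {ω | vacancy S (Γ ω) ∈ c F A} * P {ω | vacancy S (Γ ω) ∈ c F B} :=
        mul_le_mul' (measure_mono fun ω h => hsub _ _ h) (measure_mono fun ω h => hsub _ _ h)
    _ ≤ _ := by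
      simp only [mem_inter_iff, hD, hD']
      exact hΓ.harris_fintype (fun i : F => hS i) (hDu hA) (hDu' hB)

theorem isCompact_upperClosure_bool {ι : Type*} {K : Set (ι → Bool)} (hK : IsCompact K) :
    IsCompact (upperClosure K : Set (ι → Bool)) := by
  have : (upperClosure K : Set (ι → Bool)) =
      Prod.snd '' ((K ×ˢ univ) ∩ {p : (ι → Bool) × (ι → Bool) | p.1 ≤ p.2}) := by
    ext n
    simp only [SetLike.mem_coe, mem_upperClosure, mem_image, mem_inter_iff, mem_prod, mem_univ,
      and_true, mem_ofPred_eq, Prod.exists, exists_eq_right]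
  rw [this]
  have hcl : IsClosed {p : (ι → Bool) × (ι → Bool) | p.1 ≤ p.2} := by
    simp only [Pi.le_def, ofPred_forall]
    refine isClosed_iInter fun i => ?_
    exact (isClosed_discrete {q : Bool × Bool | q.1 ≤ q.2}).preimage
      (f := fun p : (ι → Bool) × (ι → Bool) => (p.1 i, p.2 i)) (by fun_prop)
  exact ((hK.prod isCompact_univ).inter_right hcl).image continuous_snd

/-- Capacitability approximates each event from within by compact sets, and passing to the upper
closure keeps these compact and inside the upper set. -/
theorem IsPoissonPointProcess.harris [IsProbabilityMeasure P]
    (hΓ : IsPoissonPointProcess P Γ μ) {ι : Type*} [Countable ι] {S : ι → Set E}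
    (hS : ∀ i, MeasurableSet (S i)) {A B : Set (ι → Bool)}
    (hA : IsUpperSet A) (hB : IsUpperSet B) (hAa : AnalyticSet A) (hBa : AnalyticSet B) :
    P {ω | vacancy S (Γ ω) ∈ A} * P {ω | vacancy S (Γ ω) ∈ B} ≤
      P {ω | vacancy S (Γ ω) ∈ A ∩ B} := by
  have hm := hΓ.measurable_vacancy hS
  have := Measure.isProbabilityMeasure_map (μ := P) hm.aemeasurable
  have happrox : ∀ {C : Set (ι → Bool)}, IsUpperSet C → AnalyticSet C → ∀ r,
      r < P {ω | vacancy S (Γ ω) ∈ C} → ∃ K ⊆ C, IsCompact K ∧ IsUpperSet K ∧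
        r ≤ P {ω | vacancy S (Γ ω) ∈ K} := by
    intro C hC hCa r hr
    have hmap : P.map (fun ω => vacancy S (Γ ω)) C = P {ω | vacancy S (Γ ω) ∈ C} :=
      Measure.map_apply₀ hm.aemeasurable (nullMeasurableSet_of_analyticSet hCa)
    obtain ⟨K, hKC, hK, hrK⟩ := exists_isCompact_of_analyticSet hCa (hmap ▸ hr)
    refine ⟨upperClosure K, fun n hn => ?_, isCompact_upperClosure_bool hK,
      (upperClosure K).upper, hrK.trans ?_⟩
    · obtain ⟨k, hk, hkn⟩ := mem_upperClosure.1 hn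
      exact hC hkn (hKC hk)
    · rw [Measure.map_apply hm hK.measurableSet]
      exact measure_mono fun ω h => subset_upperClosure h
  refine ENNReal.mul_le_of_forall_lt fun a ha b hb => ?_
  obtain ⟨K, hKA, hK, hKu, haK⟩ := happrox hA hAa a ha
  obtain ⟨L, hLB, hL, hLu, hbL⟩ := happrox hB hBa b hb
  exact (mul_le_mul' haK hbL).trans ((hΓ.harris_isCompact hS hKu hLu hK hL).trans
    (measure_mono fun ω h => ⟨hKA h.1, hLB h.2⟩))

end Harris

/-! ### Decreasing properties: FKG, invariance, independence. -/

section Decreasing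

/-- The decreasing properties of configurations that are determined, through an analytic set, by
the vacancy of countably many measurable sets. -/
def IsDecreasing (Q : Set E → Prop) : Prop :=
  ∃ (ι : Type) (_ : Countable ι) (S : ι → Set E) (A : Set (ι → Bool)),
    (∀ i, MeasurableSet (S i)) ∧ AnalyticSet A ∧ IsUpperSet A ∧ ∀ C, Q C ↔ vacancy S C ∈ A

theorem isDecreasing_inter_eq_empty {W : Set E} (hW : MeasurableSet W) :
    IsDecreasing fun C => C ∩ W = ∅ := by
  refine ⟨Unit, inferInstance, fun _ => W, {n | n () = true}, fun _ => hW, ?_, ?_, fun C => ?_⟩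
  · exact (isClosed_discrete {true}).preimage
      (f := fun n : Unit → Bool => n ()) (by fun_prop) |>.analyticSet
  · intro n m h hn
    exact Bool.le_iff_imp.1 (h ()) hn
  · simp [vacancy_eq_true]

theorem IsDecreasing.and {Q Q' : Set E → Prop} (h : IsDecreasing Q) (h' : IsDecreasing Q') :
    IsDecreasing fun C => Q C ∧ Q' C := by
  obtain ⟨ι, _, S, A, hS, hA, hAu, hQ⟩ := h
  obtain ⟨ι', _, S', A', hS', hA', hAu', hQ'⟩ := h'
  refine ⟨ι ⊕ ι', inferInstance, Sum.elim S S',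
    (fun n i => n (Sum.inl i)) ⁻¹' A ∩ (fun n i => n (Sum.inr i)) ⁻¹' A', ?_, ?_, ?_, fun C => ?_⟩
  · rintro (i | i)
    exacts [hS i, hS' i]
  · rw [inter_eq_iInter]
    refine AnalyticSet.iInter fun b => ?_
    cases b
    · exact hA'.preimage (by fun_prop)
    · exact hA.preimage (by fun_prop)
  · have hl : Monotone fun (n : ι ⊕ ι' → Bool) i => n (Sum.inl i) := fun n m h i => h _
    have hr : Monotone fun (n : ι ⊕ ι' → Bool) i => n (Sum.inr i) := fun n m h i => h _
    exact (hAu.preimage hl).inter (hAu'.preimage hr)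
  · simp only [hQ, hQ']
    rfl

theorem IsDecreasing.comp_image {Q : Set E → Prop} (h : IsDecreasing Q) {T : E → E}
    (hT : Measurable T) : IsDecreasing fun C => Q (T '' C) := by
  obtain ⟨ι, _, S, A, hS, hA, hAu, hQ⟩ := h
  refine ⟨ι, inferInstance, fun i => T ⁻¹' S i, A, fun i => hT (hS i), hA, hAu, fun C => ?_⟩
  simp only [hQ, vacancy_image]

theorem IsDecreasing.forall_lt {Q : ℕ → Set E → Prop} (h : ∀ i, IsDecreasing (Q i)) (n : ℕ) :
    IsDecreasing fun C => ∀ i < n, Q i C := by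
  induction n with
  | zero => simpa using isDecreasing_inter_eq_empty (E := E) MeasurableSet.empty
  | succ n ih => simpa only [Nat.forall_lt_succ_right] using ih.and (h n)

variable [IsProbabilityMeasure P]

/-- The Harris-FKG inequality for Poisson point processes. -/
theorem IsPoissonPointProcess.mul_le_measure_and (hΓ : IsPoissonPointProcess P Γ μ)
    {Q Q' : Set E → Prop} (h : IsDecreasing Q) (h' : IsDecreasing Q') :
    P {ω | Q (Γ ω)} * P {ω | Q' (Γ ω)} ≤ P {ω | Q (Γ ω) ∧ Q' (Γ ω)} := by
  obtain ⟨ι, _, S, A, hS, hA, hAu, hQ⟩ := h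
  obtain ⟨ι', _, S', A', hS', hA', hAu', hQ'⟩ := h'
  have := hΓ.harris (ι := ι ⊕ ι') (S := Sum.elim S S')
    (A := (fun n i => n (Sum.inl i)) ⁻¹' A) (B := (fun n i => n (Sum.inr i)) ⁻¹' A')
    (by rintro (i | i); exacts [hS i, hS' i]) (hAu.preimage fun n m h i => h _)
    (hAu'.preimage fun n m h i => h _) (hA.preimage (by fun_prop)) (hA'.preimage (by fun_prop))
  simp only [hQ, hQ']
  exact this

/-- The indicators of `T '' Γ` for the `S i` are those of `Γ` for the `T ⁻¹' S i`, and the latter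
family has the same intensities of finite unions. -/
theorem IsPoissonPointProcess.measure_image (hΓ : IsPoissonPointProcess P Γ μ)
    {Q : Set E → Prop} (h : IsDecreasing Q) {T : E → E} (hT : MeasurePreserving T μ μ) :
    P {ω | Q (T '' Γ ω)} = P {ω | Q (Γ ω)} := by
  obtain ⟨ι, _, S, A, hS, hA, hAu, hQ⟩ := h
  have hS' : ∀ i, MeasurableSet (T ⁻¹' S i) := fun i => hT.measurable (hS i)
  have hm := hΓ.measurable_vacancy hS
  have hm' := hΓ.measurable_vacancy hS'
  have := Measure.isProbabilityMeasure_map (μ := P) hm.aemeasurable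
  have := Measure.isProbabilityMeasure_map (μ := P) hm'.aemeasurable
  have hmap := hΓ.map_vacancy_congr hS hS' fun F => by
    rw [← preimage_iUnion₂, hT.measure_preimage
      (F.measurableSet_biUnion fun i _ => hS i).nullMeasurableSet]
  have h1 : P.map (fun ω => vacancy S (Γ ω)) A = P {ω | vacancy S (Γ ω) ∈ A} :=
    Measure.map_apply₀ hm.aemeasurable (nullMeasurableSet_of_analyticSet hA)
  have h2 : P.map (fun ω => vacancy (fun i => T ⁻¹' S i) (Γ ω)) A =
      P {ω | vacancy (fun i => T ⁻¹' S i) (Γ ω) ∈ A} :=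
    Measure.map_apply₀ hm'.aemeasurable (nullMeasurableSet_of_analyticSet hA)
  simp only [hQ, vacancy_image]
  rw [← h1, ← h2, hmap]

/-- Independence of the two families of indicators covers measurable events; analytic ones are a.e.
equal to measurable subsets. -/
theorem IsPoissonPointProcess.measure_and_of_disjoint (hΓ : IsPoissonPointProcess P Γ μ)
    {Q Q' : Set E → Prop} (h : IsDecreasing Q) (h' : IsDecreasing Q') {U U' : Set E}
    (hU : MeasurableSet U) (hU' : MeasurableSet U') (hd : Disjoint U U') :
    P {ω | Q (Γ ω ∩ U) ∧ Q' (Γ ω ∩ U')} = P {ω | Q (Γ ω ∩ U)} * P {ω | Q' (Γ ω ∩ U')} := by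
  obtain ⟨ι, _, S, A, hS, hA, hAu, hQ⟩ := h
  obtain ⟨ι', _, S', A', hS', hA', hAu', hQ'⟩ := h'
  have hT : ∀ i, MeasurableSet (U ∩ S i) := fun i => hU.inter (hS i)
  have hT' : ∀ i, MeasurableSet (U' ∩ S' i) := fun i => hU'.inter (hS' i)
  have e1 : ∀ C, Q (C ∩ U) ↔ vacancy (fun i => U ∩ S i) C ∈ A := fun C => by
    rw [hQ, vacancy_inter]
  have e2 : ∀ C, Q' (C ∩ U') ↔ vacancy (fun i => U' ∩ S' i) C ∈ A' := fun C => by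
    rw [hQ', vacancy_inter]
  have hm := hΓ.measurable_vacancy hT
  have hm' := hΓ.measurable_vacancy hT'
  have := Measure.isProbabilityMeasure_map (μ := P) hm.aemeasurable
  have := Measure.isProbabilityMeasure_map (μ := P) hm'.aemeasurable
  obtain ⟨B, -, hB, hBA⟩ := (nullMeasurableSet_of_analyticSet (ν := P.map
    fun ω => vacancy (fun i => U ∩ S i) (Γ ω)) hA).exists_measurable_subset_ae_eq
  obtain ⟨B', -, hB', hBA'⟩ := (nullMeasurableSet_of_analyticSet (ν := P.map
    fun ω => vacancy (fun i => U' ∩ S' i) (Γ ω)) hA').exists_measurable_subset_ae_eq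
  have f1 := ae_eq_comp hm.aemeasurable hBA
  have f2 := ae_eq_comp hm'.aemeasurable hBA'
  have hind := (hΓ.indepFun_vacancy hT hT' fun i j =>
    hd.mono inter_subset_left inter_subset_left).measure_inter_preimage_eq_mul B B' hB hB'
  simp only [e1, e2]
  have g1 : (fun ω => vacancy (fun i => U ∩ S i) (Γ ω)) ⁻¹' B =ᵐ[P]
      {ω | vacancy (fun i => U ∩ S i) (Γ ω) ∈ A} := f1
  have g2 : (fun ω => vacancy (fun i => U' ∩ S' i) (Γ ω)) ⁻¹' B' =ᵐ[P]
      {ω | vacancy (fun i => U' ∩ S' i) (Γ ω) ∈ A'} := f2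
  rw [measure_congr (g1.inter g2), measure_congr g1, measure_congr g2] at hind
  exact hind

theorem IsPoissonPointProcess.forall_lt_pos (hΓ : IsPoissonPointProcess P Γ μ)
    {Q : ℕ → Set E → Prop} (h : ∀ i, IsDecreasing (Q i)) (hpos : ∀ i, 0 < P {ω | Q i (Γ ω)})
    (n : ℕ) : 0 < P {ω | ∀ i < n, Q i (Γ ω)} := by
  induction n with
  | zero => simp
  | succ n ih =>
    simp only [Nat.forall_lt_succ_right]
    exact (ENNReal.mul_pos ih.ne' (hpos n).ne').trans_le
      (hΓ.mul_le_measure_and (IsDecreasing.forall_lt h n) (h n))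

theorem IsPoissonPointProcess.void_pos (hΓ : IsPoissonPointProcess P Γ μ)
    {W : Set E} (hW : MeasurableSet W) (hfin : μ W ≠ ∞) : 0 < P {ω | Γ ω ∩ W = ∅} := by
  rw [hΓ.measure_void hW, voidProb, if_neg hfin]
  simp [Real.exp_pos]

theorem IsPoissonPointProcess.void_lt_one (hΓ : IsPoissonPointProcess P Γ μ)
    {W : Set E} (hW : MeasurableSet W) (hpos : μ W ≠ 0) : P {ω | Γ ω ∩ W = ∅} < 1 := by
  rw [hΓ.measure_void hW, voidProb]
  split_ifs with h
  · exact zero_lt_one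
  · rw [ENNReal.ofReal_lt_one, Real.exp_lt_one_iff]
    simpa using ENNReal.toReal_pos hpos h

end Decreasing

end Poisson

/-! ### Measurability of surrounding and of path avoidance. -/

section Measurability

theorem isOpen_curve_subset {U : Set ℂ} (hU : IsOpen U) : IsOpen {γ : Curve | (γ : Set ℂ) ⊆ U} :=
  NonemptyCompacts.isOpen_subsets_of_isOpen hU

theorem isOpen_range_subset {U : Set ℂ} (hU : IsOpen U) :
    IsOpen {f : C(unitInterval, ℂ) | range f ⊆ U} := by
  have := ContinuousMap.isOpen_setOfPred_mapsTo (X := unitInterval) isCompact_univ hU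
  simpa only [mapsTo_univ_iff, range_subset_iff] using this

/-- A point is outside a compact set iff it can be connected to infinity off the set. -/
theorem notMem_fill_iff {K : Set ℂ} (hK : IsCompact K) {q : ℂ} :
    (q ∉ K ∧ q ∉ insideSet K) ↔ ∃ (n : ℕ) (J : Set ℂ), IsCompact J ∧ IsPreconnected J ∧ q ∈ J ∧
      (∃ w ∈ J, w ∉ Metric.ball 0 (n : ℝ)) ∧ K ⊆ Metric.ball 0 (n : ℝ) ∩ Jᶜ := by
  constructor
  · rintro ⟨hqK, hq⟩
    have hunb : ¬ Bornology.IsBounded (connectedComponentIn Kᶜ q) := fun h => hq ⟨hqK, h⟩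
    obtain ⟨R, hR⟩ := hK.isBounded.subset_ball 0
    obtain ⟨n, hn⟩ := exists_nat_ge R
    obtain ⟨w, hw, hwn⟩ : ∃ w ∈ connectedComponentIn Kᶜ q, w ∉ Metric.ball (0 : ℂ) n := by
      by_contra! hcon
      exact hunb (Metric.isBounded_ball.subset hcon)
    have hpc : IsPathConnected (connectedComponentIn Kᶜ q) :=
      (hK.isClosed.isOpen_compl.connectedComponentIn.isConnected_iff_isPathConnected).1
        (isConnected_connectedComponentIn_iff.2 hqK)
    obtain ⟨p, hp⟩ := hpc.joinedIn q (mem_connectedComponentIn hqK) w hw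
    refine ⟨n, range p, isCompact_range p.continuous, isPreconnected_range p.continuous,
      ⟨0, p.source⟩, ⟨w, ⟨1, p.target⟩, hwn⟩, fun z hz =>
        ⟨Metric.ball_subset_ball hn (hR hz), ?_⟩⟩
    rintro ⟨t, rfl⟩
    exact connectedComponentIn_subset _ _ (hp t) hz
  · rintro ⟨n, J, -, hJ, hqJ, ⟨w, hwJ, hwn⟩, hKJ⟩
    have hJK : J ⊆ Kᶜ := fun z hz hzK => (hKJ hzK).2 hz
    refine ⟨hJK hqJ, fun h => ?_⟩
    have hw := hJ.subset_connectedComponentIn hqJ hJK hwJ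
    have hb := h.2
    rw [connectedComponentIn_eq hw] at hb
    exact not_isBounded_connectedComponentIn (hKJ.trans inter_subset_left) hwn hb

/-- The compact connected set that links `q` to infinity off `s x` still works for all nearby `x`.
-/
theorem isOpen_notMem_fill {X : Type*} [TopologicalSpace X] {s : X → Set ℂ}
    (hc : ∀ x, IsCompact (s x)) (hs : ∀ U, IsOpen U → IsOpen {x | s x ⊆ U}) (q : ℂ) :
    IsOpen {x | q ∉ s x ∧ q ∉ insideSet (s x)} := by
  simp only [notMem_fill_iff (hc _)]
  rw [isOpen_iff_forall_mem_open]
  rintro x ⟨n, J, hJ, h⟩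
  refine ⟨_, fun y hy => ?_, hs _ (Metric.isOpen_ball.inter hJ.isClosed.isOpen_compl), h.2.2.2⟩
  exact ⟨n, J, hJ, h.1, h.2.1, h.2.2.1, hy⟩

/-- Both sets on the right are open when `s x` is compact and depends on `x` upper semicontinuously,
so surrounding `q` is a Borel condition. -/
theorem mem_insideSet_eq_diff {X : Type*} (s : X → Set ℂ) (q : ℂ) :
    {x | q ∈ insideSet (s x)} =
      {x | s x ⊆ {q}ᶜ} \ {x | q ∉ s x ∧ q ∉ insideSet (s x)} := by
  ext x
  simp only [mem_ofPred_eq, Set.mem_sdiff, subset_compl_singleton_iff, not_and, not_not]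
  exact ⟨fun h => ⟨h.1, fun _ => h⟩, fun h => h.2 h.1⟩

theorem measurableSet_mem_inside (q : ℂ) : MeasurableSet {γ : Curve | q ∈ inside γ} := by
  simp only [inside_eq_insideSet]
  rw [mem_insideSet_eq_diff]
  exact (isOpen_curve_subset isOpen_compl_singleton).measurableSet.diff
    (isOpen_notMem_fill (fun γ : Curve => γ.isCompact) (fun _ => isOpen_curve_subset)
      q).measurableSet

theorem analyticSet_inter {X : Type*} [TopologicalSpace X] [T2Space X] {A B : Set X}
    (hA : AnalyticSet A) (hB : AnalyticSet B) : AnalyticSet (A ∩ B) := by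
  rw [inter_eq_iInter]
  exact AnalyticSet.iInter fun b => by cases b <;> assumption

theorem analyticSet_mem_insideSet_range (q : ℂ) :
    AnalyticSet {f : C(unitInterval, ℂ) | q ∈ insideSet (range f)} := by
  rw [mem_insideSet_eq_diff, sdiff_eq]
  exact analyticSet_inter (by
      simpa using (isOpen_range_subset (U := {q}ᶜ) isOpen_compl_singleton).analyticSet_image
        continuous_id)
    (isOpen_notMem_fill (fun f : C(unitInterval, ℂ) => isCompact_range f.continuous)
      (fun _ => isOpen_range_subset) q).isClosed_compl.analyticSet

/-- Interiors are open, hence unions of balls from a countable base. So `f` avoids all interiors iff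
it avoids each base ball contained in the interior of some loop of `C ∩ U`, and whether such a loop
exists is one vacancy indicator. -/
theorem isDecreasing_exists_avoid {G : Set C(unitInterval, ℂ)} (hG : AnalyticSet G)
    {U : Set Curve} (hU : MeasurableSet U) :
    IsDecreasing fun C : Set Curve => ∃ f ∈ G, ∀ γ ∈ C, γ ∈ U → ∀ t, f t ∉ inside γ := by
  let B : ℕ × ℕ → Set ℂ := fun p => Metric.ball (denseSeq ℂ p.1) (1 / (p.2 + 1))
  have hBo : ∀ p, IsOpen (B p) := fun p => Metric.isOpen_ball
  have hBmem : ∀ p : ℕ × ℕ, denseSeq ℂ p.1 ∈ B p := fun p => Metric.mem_ball_self (by positivity)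
  let S : ℕ × ℕ → Set Curve := fun p =>
    U ∩ ({γ | (γ : Set ℂ) ⊆ (B p)ᶜ} ∩ {γ | denseSeq ℂ p.1 ∈ inside γ})
  have hSB : ∀ p, ∀ γ ∈ S p, B p ⊆ inside γ := fun p γ hγ =>
    subset_insideSet_of_isPreconnected (convex_ball _ _).isPreconnected
      (disjoint_left.2 fun z hz hzγ => hγ.2.1 hzγ hz) (hBmem p) hγ.2.2
  have hBS : ∀ p, ∀ γ ∈ U, B p ⊆ inside γ → γ ∈ S p := fun p γ hγ h =>
    ⟨hγ, fun z hz hzB => (h hzB).1 hz, h (hBmem p)⟩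
  have hex : ∀ V : Set ℂ, IsOpen V → ∀ x ∈ V, ∃ p, x ∈ B p ∧ B p ⊆ V := by
    intro V hV x hx
    obtain ⟨r, hr, hball⟩ := Metric.isOpen_iff.1 hV x hx
    obtain ⟨j, hj⟩ := exists_nat_one_div_lt (half_pos hr)
    obtain ⟨i, hi⟩ := (denseRange_denseSeq ℂ).exists_dist_lt x
      (show (0 : ℝ) < 1 / (j + 1) by positivity)
    refine ⟨(i, j), hi, fun y hy => hball ?_⟩
    have hy' : dist y (denseSeq ℂ i) < 1 / (j + 1) := hy
    rw [Metric.mem_ball]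
    calc dist y x ≤ dist y (denseSeq ℂ i) + dist x (denseSeq ℂ i) := dist_triangle_right _ _ _
      _ < r := by linarith
  refine ⟨ℕ × ℕ, inferInstance, S,
    {n | ∃ f ∈ G, ∀ p, n p = false → ∀ t, f t ∉ B p}, fun p => ?_, ?_, ?_, fun C => ?_⟩
  · refine hU.inter (MeasurableSet.inter ?_ (measurableSet_mem_inside _))
    exact (NonemptyCompacts.isClosed_subsets_of_isClosed (hBo p).isClosed_compl).measurableSet
  · have hset : {n : ℕ × ℕ → Bool | ∃ f ∈ G, ∀ p, n p = false → ∀ t, f t ∉ B p} =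
        Prod.fst '' ((Prod.snd ⁻¹' G) ∩ {x : (ℕ × ℕ → Bool) × C(unitInterval, ℂ) |
          ∀ p t, x.1 p = true ∨ x.2 t ∈ (B p)ᶜ}) := by
      ext n
      simp only [mem_ofPred_eq, mem_image, mem_inter_iff, mem_preimage, Prod.exists,
        exists_and_right, exists_eq_right]
      refine exists_congr fun f => and_congr_right fun _ => forall_congr' fun p => ?_
      cases n p <;> simp
    rw [hset]
    refine (analyticSet_inter (hG.preimage continuous_snd)
      (IsClosed.analyticSet ?_)).image_of_continuous continuous_fst
    simp only [ofPred_forall]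
    refine isClosed_iInter fun p => isClosed_iInter fun t => IsClosed.union ?_ ?_
    · exact (isClosed_discrete {true}).preimage
        (f := fun x : (ℕ × ℕ → Bool) × C(unitInterval, ℂ) => x.1 p) (by fun_prop)
    · exact (hBo p).isClosed_compl.preimage
        (f := fun x : (ℕ × ℕ → Bool) × C(unitInterval, ℂ) => x.2 t) (by fun_prop)
  · rintro n m h ⟨f, hf, hfn⟩
    refine ⟨f, hf, fun p hp => hfn p ?_⟩
    exact Bool.eq_false_of_le_false (hp ▸ h p)
  · constructor
    · rintro ⟨f, hf, h⟩
      refine ⟨f, hf, fun p hp t ht => ?_⟩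
      obtain ⟨γ, hγC, hγ⟩ := vacancy_eq_false.1 hp
      exact h γ hγC hγ.1 t (hSB p γ hγ ht)
    · rintro ⟨f, hf, h⟩
      refine ⟨f, hf, fun γ hγC hγU t ht => ?_⟩
      obtain ⟨p, hp, hpV⟩ := hex _ (isOpen_insideSet γ.isCompact.isClosed) _ ht
      exact h p (vacancy_eq_false.2 ⟨γ, hγC, hBS p γ hγU hpV⟩) t hp

end Measurability

/-! ### The path and circuit events. -/

section Events

/-- The ring `{r < |z| < R}`. -/
def ring (r R : ℝ) : Set ℂ := {z | r < ‖z‖ ∧ ‖z‖ < R}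

theorem isOpen_ring (r R : ℝ) : IsOpen (ring r R) :=
  (isOpen_lt continuous_const continuous_norm).inter (isOpen_lt continuous_norm continuous_const)

/-- The points that are in the interior of no curve of `C` contained in a ring. -/
def free (r R : ℝ) (C : Set Curve) : Set ℂ :=
  {z | ∀ γ ∈ C, (γ : Set ℂ) ⊆ ring r R → z ∉ inside γ}

/-- There is a path from the origin to the circle of radius `R` that avoids the interiors of the
curves of `C` in the ring `{r < |z| < R}`. -/
def HasPath (r R : ℝ) (C : Set Curve) : Prop := ∃ w : ℂ, ‖w‖ = R ∧ JoinedIn (free r R C) 0 w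

theorem eventA_eq {Ω : Type*} (Γ : Ω → Set Curve) (ε : ℝ) :
    eventA Γ ε = {ω | HasPath ε 1 (Γ ω)} := by
  ext ω
  constructor
  · rintro ⟨w, p, hw, hp⟩
    exact ⟨w, hw, p, fun t γ hγ hr => hp γ ⟨hγ, hr⟩ t⟩
  · rintro ⟨w, hw, p, hp⟩
    exact ⟨w, p, hw, fun γ hγ t => hp t γ hγ.1 hγ.2⟩

/-- There is a closed connected path in the ring `{r < |z - a| < R}` that surrounds `a` and
avoids the interiors of the curves of `C` that do not surround `a`. -/
def HasCircuit (a : ℂ) (r R : ℝ) (C : Set Curve) : Prop :=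
  ∃ f : C(unitInterval, ℂ), (∀ t, r < ‖f t - a‖ ∧ ‖f t - a‖ < R) ∧ a ∈ insideSet (range f) ∧
    ∀ γ ∈ C, a ∉ inside γ → ∀ t, f t ∉ inside γ

theorem isDecreasing_hasPath (r R : ℝ) : IsDecreasing (HasPath r R) := by
  have h0 : IsClosed {f : C(unitInterval, ℂ) | f 0 = 0} := isClosed_eq (by fun_prop) (by fun_prop)
  have h1 : IsClosed {f : C(unitInterval, ℂ) | ‖f 1‖ = R} :=
    isClosed_eq (by fun_prop) (by fun_prop)
  have hG : AnalyticSet {f : C(unitInterval, ℂ) | f 0 = 0 ∧ ‖f 1‖ = R} := (h0.inter h1).analyticSet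
  convert isDecreasing_exists_avoid hG (isOpen_curve_subset (isOpen_ring r R)).measurableSet
    using 2 with C
  constructor
  · rintro ⟨w, hw, p, hp⟩
    exact ⟨p, ⟨p.source, by simpa using hw⟩, fun γ hγ hU t => hp t γ hγ hU⟩
  · rintro ⟨f, ⟨h0, h1⟩, hf⟩
    exact ⟨f 1, h1, ⟨f, h0, rfl⟩, fun t γ hγ hU => hf γ hγ hU t⟩

theorem isDecreasing_hasCircuit (a : ℂ) (r R : ℝ) : IsDecreasing (HasCircuit a r R) := by
  have h0 : IsOpen {z : ℂ | r < ‖z - a‖} := isOpen_lt (by fun_prop) (by fun_prop)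
  have h1 : IsOpen {z : ℂ | ‖z - a‖ < R} := isOpen_lt (by fun_prop) (by fun_prop)
  have hopen : IsOpen {z : ℂ | r < ‖z - a‖ ∧ ‖z - a‖ < R} := h0.inter h1
  have hG := analyticSet_inter (by
      simpa using (isOpen_range_subset hopen).analyticSet_image continuous_id)
    (analyticSet_mem_insideSet_range a)
  convert isDecreasing_exists_avoid hG (measurableSet_mem_inside a).compl using 2 with C
  simp only [HasCircuit, mem_inter_iff, mem_ofPred_eq, range_subset_iff, mem_compl_iff, and_assoc]

theorem HasCircuit.mono {a : ℂ} {r R r' R' : ℝ} {C : Set Curve} (h : HasCircuit a r R C)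
    (hr : r' ≤ r) (hR : R ≤ R') : HasCircuit a r' R' C := by
  obtain ⟨f, h1, h2⟩ := h
  exact ⟨f, fun t => ⟨hr.trans_lt (h1 t).1, (h1 t).2.trans_le hR⟩, h2⟩

end Events

/-! ### Translations and scalings. -/

section Affine

theorem insideSet_image (e : ℂ ≃ₜ ℂ) (K : Set ℂ) : insideSet (e '' K) = e '' insideSet K := by
  have hb : ∀ (e : ℂ ≃ₜ ℂ) (s : Set ℂ), Bornology.IsBounded s → Bornology.IsBounded (e '' s) :=
    fun e s hs => (hs.isCompact_closure.image e.continuous).isBounded.subset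
      (image_mono subset_closure)
  have hsub : ∀ (e : ℂ ≃ₜ ℂ) (K : Set ℂ), e '' insideSet K ⊆ insideSet (e '' K) := by
    rintro e K _ ⟨z, hz, rfl⟩
    refine ⟨fun h => hz.1 ((e.injective.mem_set_image).1 h), ?_⟩
    rw [← image_compl_eq e.bijective, ← e.image_connectedComponentIn hz.1]
    exact hb e _ hz.2
  refine Subset.antisymm (fun z hz => ?_) (hsub e K)
  have := hsub e.symm (e '' K) ⟨z, hz, rfl⟩
  rw [← image_comp] at this
  exact ⟨e.symm z, by simpa using this, by simp⟩

/-- The affine map `z ↦ ρ⁻¹ (z - a)` as a homeomorphism. -/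
noncomputable def recenterHomeomorph (a : ℂ) {ρ : ℝ} (hρ : 0 < ρ) : ℂ ≃ₜ ℂ :=
  (Homeomorph.addLeft (-a)).trans
    (Homeomorph.mulLeft₀ ((ρ⁻¹ : ℝ) : ℂ) (by exact_mod_cast (inv_pos.2 hρ).ne'))

theorem recenterHomeomorph_apply (a : ℂ) {ρ : ℝ} (hρ : 0 < ρ) (z : ℂ) :
    recenterHomeomorph a hρ z = ((ρ⁻¹ : ℝ) : ℂ) * (-a + z) := rfl

theorem norm_recenterHomeomorph (a : ℂ) {ρ : ℝ} (hρ : 0 < ρ) (z : ℂ) :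
    ‖recenterHomeomorph a hρ z‖ = ‖z - a‖ / ρ := by
  rw [recenterHomeomorph_apply, norm_mul, Complex.norm_real, Real.norm_eq_abs,
    abs_of_pos (inv_pos.2 hρ), neg_add_eq_sub, div_eq_inv_mul]

/-- The action of `z ↦ ρ⁻¹ (z - a)` on curves. -/
noncomputable def recenter (a : ℂ) (ρ : ℝ) (γ : Curve) : Curve := scale ρ⁻¹ (translate (-a) γ)

theorem coe_recenter (a : ℂ) {ρ : ℝ} (hρ : 0 < ρ) (γ : Curve) :
    (recenter a ρ γ : Set ℂ) = recenterHomeomorph a hρ '' (γ : Set ℂ) := by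
  simp only [recenter, scale, translate, NonemptyCompacts.coe_map, image_image]
  rfl

theorem inside_recenter (a : ℂ) {ρ : ℝ} (hρ : 0 < ρ) (γ : Curve) :
    inside (recenter a ρ γ) = recenterHomeomorph a hρ '' inside γ := by
  rw [inside_eq_insideSet, coe_recenter a hρ, insideSet_image, inside_eq_insideSet]

theorem IsInvariantMeasure.measurePreserving_recenter {μ : Measure Curve}
    (hμ : IsInvariantMeasure μ) (a : ℂ) {ρ : ℝ} (hρ : 0 < ρ) :
    MeasurePreserving (recenter a ρ) μ μ :=
  (hμ.scale_invariant ρ⁻¹ (inv_pos.2 hρ)).comp (hμ.translation_invariant (-a))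

theorem mem_free_recenter_iff {ρ : ℝ} (hρ : 0 < ρ) {r R : ℝ} {C : Set Curve} {z : ℂ} :
    recenterHomeomorph 0 hρ z ∈ free r R (recenter 0 ρ '' C) ↔ z ∈ free (ρ * r) (ρ * R) C := by
  have hring : ∀ z, recenterHomeomorph 0 hρ z ∈ ring r R ↔ z ∈ ring (ρ * r) (ρ * R) := fun z => by
    simp only [ring, mem_ofPred_eq, norm_recenterHomeomorph, sub_zero, lt_div_iff₀' hρ,
      div_lt_iff₀' hρ]
  simp only [free, mem_ofPred_eq, forall_mem_image]
  refine forall₂_congr fun γ _ => ?_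
  rw [coe_recenter 0 hρ, inside_recenter 0 hρ, (recenterHomeomorph 0 hρ).injective.mem_set_image,
    image_subset_iff]
  exact imp_congr (forall₂_congr fun z _ => hring z) Iff.rfl

theorem hasPath_recenter_iff {ρ : ℝ} (hρ : 0 < ρ) {r R : ℝ} {C : Set Curve} :
    HasPath r R (recenter 0 ρ '' C) ↔ HasPath (ρ * r) (ρ * R) C := by
  set e := recenterHomeomorph 0 hρ
  have he0 : e 0 = 0 := by simp [e, recenterHomeomorph_apply]
  have himg : e '' free (ρ * r) (ρ * R) C = free r R (recenter 0 ρ '' C) := by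
    ext z
    obtain ⟨w, rfl⟩ := e.surjective z
    rw [e.injective.mem_set_image, mem_free_recenter_iff]
  have hnorm : ∀ w, ‖e w‖ = R ↔ ‖w‖ = ρ * R := fun w => by
    rw [norm_recenterHomeomorph, sub_zero, div_eq_iff hρ.ne', mul_comm]
  constructor
  · rintro ⟨w, hw, hj⟩
    refine ⟨e.symm w, by rw [← hnorm, e.apply_symm_apply, hw], ?_⟩
    have := hj.map e.symm.continuous
    have hs : e.symm '' (e '' free (ρ * r) (ρ * R) C) = free (ρ * r) (ρ * R) C := by
      rw [← image_comp, e.symm_comp_self, image_id]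
    rwa [← himg, hs, show e.symm 0 = 0 by rw [e.symm_apply_eq, he0]] at this
  · rintro ⟨w, hw, hj⟩
    refine ⟨e w, (hnorm w).2 hw, ?_⟩
    have := hj.map e.continuous
    rwa [himg, he0] at this

theorem HasCircuit.of_recenter {a : ℂ} {ρ : ℝ} (hρ : 0 < ρ) {r R : ℝ} {C : Set Curve}
    (h : HasCircuit 0 r R (recenter a ρ '' C)) : HasCircuit a (ρ * r) (ρ * R) C := by
  obtain ⟨f, hf, hin, havoid⟩ := h
  set e := recenterHomeomorph a hρ
  have hea : e a = 0 := by simp [e, recenterHomeomorph_apply]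
  have hnorm : ∀ z, ‖e.symm z - a‖ = ρ * ‖z‖ := fun z => by
    have := norm_recenterHomeomorph a hρ (e.symm z)
    rw [e.apply_symm_apply] at this
    rw [this]
    field_simp
  refine ⟨⟨fun t => e.symm (f t), by fun_prop⟩, fun t => ?_, ?_, fun γ hγ ha t ht => ?_⟩
  · have hft := hf t
    simp only [sub_zero] at hft
    simp only [ContinuousMap.coe_mk, hnorm]
    exact ⟨mul_lt_mul_of_pos_left hft.1 hρ, mul_lt_mul_of_pos_left hft.2 hρ⟩
  · have hr : range (fun t => e.symm (f t)) = e.symm '' range f := range_comp _ _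
    rw [ContinuousMap.coe_mk, hr, insideSet_image]
    exact ⟨0, hin, by rw [e.symm_apply_eq, hea]⟩
  · refine havoid _ ⟨γ, hγ, rfl⟩ ?_ t ?_
    · rw [inside_recenter a hρ, ← hea, e.injective.mem_set_image]
      exact ha
    · rw [inside_recenter a hρ]
      exact ⟨_, ht, e.apply_symm_apply _⟩

end Affine

/-! ### Building paths from circuits. -/

section Gluing

theorem isPathConnected_range_curve (f : C(unitInterval, ℂ)) : IsPathConnected (range f) := by
  have : PathConnectedSpace unitInterval := isPathConnected_iff_pathConnectedSpace.1
    ((convex_Icc (0 : ℝ) 1).isPathConnected ⟨0, by simp⟩)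
  exact isPathConnected_range f.continuous

/-- If `l` enters the interior of `γ` without crossing, then `γ` misses the interior of `l`. The
component of `0` off `l`, whose closure contains `l`, then meets the interior of `γ` and avoids `γ`,
so `γ` surrounds `0`. Hence the exemption in `HasCircuit` for loops that surround the centre. -/
theorem IsSimpleLoop.exists_hasCircuit {l : Curve} (hl : IsSimpleLoop l) (h0 : (0 : ℂ) ∈ inside l)
    {C : Set Curve} (hC : ∀ γ ∈ C, ¬ Cross l γ) :
    ∃ m : ℕ, HasCircuit 0 (1 / (m + 1)) (m + 1) C := by
  obtain ⟨x, hx⟩ := l.nonempty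
  obtain ⟨c, hc, -, -, -, himg⟩ := hl.exists_param hx
  have hr : range (fun t : unitInterval => c t) = (l : Set ℂ) := by
    rw [← himg, image_eq_range]
  obtain ⟨B, hB⟩ := l.isCompact.isBounded.subset_ball 0
  obtain ⟨δ, hδ, hball⟩ := Metric.isOpen_iff.1 l.isCompact.isClosed.isOpen_compl 0 h0.1
  obtain ⟨m₁, hm₁⟩ := exists_nat_ge B
  obtain ⟨m₂, hm₂⟩ := exists_nat_one_div_lt hδ
  refine ⟨max m₁ m₂, ⟨fun t => c t, by fun_prop⟩, fun t => ?_, ?_, fun γ hγ hγ0 t ht => ?_⟩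
  · have hct : c t ∈ (l : Set ℂ) := hr ▸ mem_range_self t
    simp only [ContinuousMap.coe_mk, sub_zero]
    constructor
    · have h1 : δ ≤ ‖c t‖ := by
        by_contra hlt
        exact hball (mem_ball_zero_iff.2 (not_le.1 hlt)) hct
      refine lt_of_le_of_lt ?_ (hm₂.trans_le h1)
      apply one_div_le_one_div_of_le (by positivity)
      push_cast
      gcongr
      exact le_max_right _ _
    · have h1 := mem_ball_zero_iff.1 (hB hct)
      have h2 : (m₁ : ℝ) ≤ (max m₁ m₂ : ℕ) := by exact_mod_cast le_max_left _ _
      linarith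
  · rw [ContinuousMap.coe_mk, hr]
    exact h0
  · have hct : c t ∈ (l : Set ℂ) := hr ▸ mem_range_self t
    have hdis : Disjoint (inside l) (γ : Set ℂ) := by
      rw [disjoint_iff_inter_eq_empty, ← not_nonempty_iff_eq_empty]
      rintro ⟨y, hy, hyγ⟩
      exact hC γ hγ ⟨⟨_, hct, ht⟩, ⟨y, hyγ, hy⟩⟩
    obtain ⟨y, hyγ, hyl⟩ := mem_closure_iff.1 (hl.subset_closure h0 hct) _
      (isOpen_insideSet γ.isCompact.isClosed) ht
    exact hγ0 (subset_insideSet_of_isPreconnected isPreconnected_connectedComponentIn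
      (hdis.mono_left (connectedComponentIn_subset_insideSet h0)) hyl hyγ
      (mem_connectedComponentIn h0.1))

theorem hasPath_of_joinedIn {r R : ℝ} (hR : 0 ≤ R) {C : Set Curve} {b : ℂ}
    (h : JoinedIn (free r R C) 0 b) (hb : R ≤ ‖b‖) : HasPath r R C := by
  obtain ⟨p, hp⟩ := h
  have hex : ∃ t, p t ∈ Metric.sphere (0 : ℂ) R := by
    have := isPreconnected_univ.intermediate_value₂ (a := (0 : unitInterval)) (b := 1)
      (mem_univ _) (mem_univ _) (f := fun t => ‖p t‖) (g := fun _ => R)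
      (by fun_prop) (by fun_prop) (by simpa using hR) (by simpa using hb)
    obtain ⟨t, -, ht⟩ := this
    exact ⟨t, by simpa using ht⟩
  obtain ⟨z, hz, hj⟩ := exists_joinedIn_first_hit p Metric.isClosed_sphere hex
  refine ⟨z, by simpa using hz, hj.mono ?_⟩
  rintro _ ⟨⟨t, rfl⟩, -⟩
  exact hp t

theorem HasPath.mono {r R r' R' : ℝ} {C : Set Curve} (h : HasPath r R C) (hr : r ≤ r')
    (hR' : 0 ≤ R') (hR : R' ≤ R) : HasPath r' R' C := by
  obtain ⟨w, hw, hj⟩ := h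
  refine hasPath_of_joinedIn hR' (hj.mono fun z hz γ hγ hγr => hz γ hγ fun y hy => ?_)
    (hR.trans_eq hw.symm)
  exact ⟨hr.trans_lt (hγr hy).1, (hγr hy).2.trans_le hR⟩

/-- Only loops in the ring matter, which brings path events into the form required by
`measure_and_of_disjoint`. -/
theorem hasPath_inter_iff {r R : ℝ} {C : Set Curve} :
    HasPath r R (C ∩ {γ | (γ : Set ℂ) ⊆ ring r R}) ↔ HasPath r R C := by
  have : free r R (C ∩ {γ | (γ : Set ℂ) ⊆ ring r R}) = free r R C := by
    ext z
    exact ⟨fun h γ hγ hr => h γ ⟨hγ, hr⟩ hr, fun h γ hγ hr => h γ hγ.1 hr⟩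
  simp only [HasPath, this]

/-- If a curve has an interior point in a component of the complement of a set that avoids its
interior, then the curve lies in the closure of this component. -/
theorem IsSimpleLoop.subset_component_union {γ : Curve} (hγ : IsSimpleLoop γ) {l : Set ℂ}
    (hl : IsClosed l) (hd : Disjoint l (inside γ)) {x z : ℂ} (hz : z ∈ connectedComponentIn lᶜ x)
    (hzγ : z ∈ inside γ) : (γ : Set ℂ) ⊆ connectedComponentIn lᶜ x ∪ l := by
  have hV : connectedComponentIn (γ : Set ℂ)ᶜ z ⊆ connectedComponentIn lᶜ x := by
    rw [connectedComponentIn_eq hz]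
    refine isPreconnected_connectedComponentIn.subset_connectedComponentIn
      (mem_connectedComponentIn hzγ.1) fun w hw hwl => ?_
    exact disjoint_left.1 hd hwl (connectedComponentIn_subset_insideSet hzγ hw)
  exact (hγ.subset_closure hzγ).trans ((closure_mono hV).trans
    (closure_connectedComponentIn_subset hl x))

theorem exists_mem_of_notMem_connectedComponentIn {l : Set ℂ} {x y : ℂ} (p : Path x y)
    (hy : y ∉ connectedComponentIn lᶜ x) : ∃ t, p t ∈ l := by
  by_contra! hcon
  refine hy ((isPreconnected_range p.continuous).subset_connectedComponentIn ⟨0, p.source⟩ ?_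
    ⟨1, p.target⟩)
  rintro _ ⟨t, rfl⟩
  exact hcon t

/-- Two paths that cross the same circuit can be joined. -/
theorem HasPath.glue {r a b R : ℝ} (ha : 0 ≤ a) (hbR : b ≤ R) {C : Set Curve}
    (hC : ∀ γ ∈ C, IsSimpleLoop γ) (hout : HasPath a R C) (hin : HasPath r b C)
    (hcirc : HasCircuit 0 a b C)
    (hcross : ∀ γ ∈ C, (γ : Set ℂ) ⊆ (Metric.closedBall 0 a)ᶜ ∨ (γ : Set ℂ) ⊆ Metric.ball 0 b) :
    HasPath r R C := by
  obtain ⟨f, hf, h0, hfree⟩ := hcirc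
  obtain ⟨w₁, hw₁, p₁, hp₁⟩ := hout
  obtain ⟨w₂, hw₂, p₂, hp₂⟩ := hin
  simp only [sub_zero] at hf
  set l := range f
  have hl : IsClosed l := (isCompact_range f.continuous).isClosed
  have hlb : l ⊆ Metric.ball 0 b := by
    rintro _ ⟨t, rfl⟩
    exact mem_ball_zero_iff.2 (hf t).2
  have hla : Disjoint (Metric.closedBall 0 a) l := by
    rw [disjoint_right]
    rintro _ ⟨t, rfl⟩ h
    exact (hf t).1.not_ge (mem_closedBall_zero_iff.1 h)
  have hC0 : connectedComponentIn lᶜ 0 ⊆ Metric.ball 0 b :=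
    (connectedComponentIn_subset_insideSet h0).trans (insideSet_subset_ball hlb)
  have hball : Metric.closedBall 0 a ⊆ connectedComponentIn lᶜ (0 : ℂ) :=
    (convex_closedBall _ _).isPreconnected.subset_connectedComponentIn
      (Metric.mem_closedBall_self ha) hla.subset_compl_right
  have hmemOut : ∀ γ : Curve, (γ : Set ℂ) ⊆ ring r R → (γ : Set ℂ) ⊆ (Metric.closedBall 0 a)ᶜ →
      (γ : Set ℂ) ⊆ ring a R := fun γ h1 h2 z hz =>
    ⟨by simpa using h2 hz, (h1 hz).2⟩
  have hmemIn : ∀ γ : Curve, (γ : Set ℂ) ⊆ ring r R → (γ : Set ℂ) ⊆ Metric.ball 0 b →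
      (γ : Set ℂ) ⊆ ring r b := fun γ h1 h2 z hz =>
    ⟨(h1 hz).1, by simpa using h2 hz⟩
  -- A loop of the ring that surrounds the origin would, by `hcross`, be one of the loops that `p₁`
  -- or `p₂` has to avoid; but both paths start at the origin.
  have hlfree : ∀ γ ∈ C, (γ : Set ℂ) ⊆ ring r R → Disjoint l (inside γ) := by
    intro γ hγ hγr
    by_cases hγ0 : (0 : ℂ) ∈ inside γ
    · exfalso
      rcases hcross γ hγ with h | h
      · exact hp₁ 0 γ hγ (hmemOut γ hγr h) (by simpa using hγ0)
      · exact hp₂ 0 γ hγ (hmemIn γ hγr h) (by simpa using hγ0)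
    · rw [disjoint_left]
      rintro _ ⟨t, rfl⟩
      exact hfree γ hγ hγ0 t
  have hw₂C : w₂ ∉ connectedComponentIn lᶜ 0 := fun h => by
    have := mem_ball_zero_iff.1 (hC0 h)
    linarith
  have hw₁C : w₁ ∉ connectedComponentIn lᶜ 0 := fun h => by
    have := mem_ball_zero_iff.1 (hC0 h)
    linarith
  have hw₁l : w₁ ∉ l := fun h => by
    have := mem_ball_zero_iff.1 (hlb h)
    linarith
  have h0w : (0 : ℂ) ∉ connectedComponentIn lᶜ w₁ := fun h => by
    have hm := mem_connectedComponentIn (F := lᶜ) hw₁l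
    rw [connectedComponentIn_eq h] at hm
    exact hw₁C hm
  obtain ⟨z₂, hz₂, hj₂⟩ := exists_joinedIn_first_hit p₂ hl
    (exists_mem_of_notMem_connectedComponentIn p₂ hw₂C)
  obtain ⟨z₁, hz₁, hj₁⟩ := exists_joinedIn_first_hit p₁.symm hl
    (exists_mem_of_notMem_connectedComponentIn p₁.symm h0w)
  -- Up to its first hit of `l`, the inner path can only be obstructed by loops in the closed
  -- component of `0`, and these lie in the ball of radius `b`.
  have hsub₂ : range p₂ ∩ (l ∪ connectedComponentIn lᶜ 0) ⊆ free r R C := by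
    rintro _ ⟨⟨t, rfl⟩, ht⟩ γ hγ hγr hin
    have hd := hlfree γ hγ hγr
    rcases ht with ht | ht
    · exact disjoint_left.1 hd ht hin
    · exact hp₂ t γ hγ (hmemIn γ hγr (((hC γ hγ).subset_component_union hl hd ht hin).trans
        (union_subset hC0 hlb))) hin
  -- Symmetrically, read from its far end, the outer path stays outside `l` until it hits `l`, where
  -- obstructing loops miss the disk of radius `a`.
  have hsub₁ : range p₁.symm ∩ (l ∪ connectedComponentIn lᶜ w₁) ⊆ free r R C := by
    rintro _ ⟨ht', ht⟩ γ hγ hγr hin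
    rw [Path.symm_range] at ht'
    obtain ⟨t, rfl⟩ := ht'
    have hd := hlfree γ hγ hγr
    rcases ht with ht | ht
    · exact disjoint_left.1 hd ht hin
    · refine hp₁ t γ hγ (hmemOut γ hγr fun z hz hza => ?_) hin
      rcases (hC γ hγ).subset_component_union hl hd ht hin hz with h | h
      · have := hball hza
        rw [connectedComponentIn_eq this, ← connectedComponentIn_eq h] at hw₁C
        exact hw₁C (mem_connectedComponentIn hw₁l)
      · exact disjoint_left.1 hla hza h
  have hlf : l ⊆ free r R C := fun z hz γ hγ hγr hin =>
    disjoint_left.1 (hlfree γ hγ hγr) hz hin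
  have hjl : JoinedIn l z₂ z₁ := (isPathConnected_range_curve f).joinedIn _ hz₂ _ hz₁
  exact ⟨w₁, hw₁, ((hj₂.mono hsub₂).trans (hjl.mono hlf)).trans (hj₁.mono hsub₁).symm⟩

/-- A ray that misses `L` would be an unbounded connected subset of a bounded component. -/
theorem exists_mem_ray {L : Set ℂ} {x v : ℂ} (hx : x ∈ L ∪ insideSet L) (hv : v ≠ 0) :
    ∃ t : ℝ, 0 ≤ t ∧ x + t * v ∈ L := by
  by_contra! hcon
  have hxL : x ∉ L := by simpa using hcon 0 le_rfl
  have hb := (hx.resolve_left hxL).2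
  have hpre : IsPreconnected ((fun t : ℝ => x + t * v) '' Ici 0) :=
    isPreconnected_Ici.image _ (by fun_prop)
  have hsub := hpre.subset_connectedComponentIn (x := x) (F := Lᶜ) ⟨0, mem_Ici.2 le_rfl, by simp⟩
    (by rintro _ ⟨t, ht, rfl⟩; exact hcon t ht)
  obtain ⟨B, hB⟩ := (hb.subset hsub).subset_ball x
  have hv' := norm_pos_iff.2 hv
  have := hB ⟨|B| / ‖v‖, mem_Ici.2 (by positivity), rfl⟩
  rw [mem_ball_iff_norm, add_sub_cancel_left, norm_mul, Complex.norm_real, Real.norm_eq_abs,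
    abs_of_nonneg (by positivity), div_mul_cancel₀ _ hv'.ne'] at this
  exact (le_abs_self B).not_gt this

/-- A chain of small circuits along the unit segment gives a path to the unit circle. -/
theorem hasPath_of_circuits {ε r s : ℝ} {n : ℕ} (hn : 0 < n) (hnr : 1 / (n : ℝ) < r) (hs : s ≤ ε)
    {C : Set Curve} (hcirc : ∀ i < n + 1, HasCircuit ((i / n : ℝ) : ℂ) r s C)
    (hsmall : ∀ γ ∈ C, (γ : Set ℂ) ⊆ Metric.ball 0 1 → ∀ x ∈ (γ : Set ℂ), ∀ y ∈ (γ : Set ℂ),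
      dist x y ≤ r / 4) : HasPath ε 1 C := by
  have hn' : (0 : ℝ) < n := by exact_mod_cast hn
  have hr : 0 < r := lt_trans (by positivity) hnr
  have hcirc' : ∀ i : ℕ, ∃ f : C(unitInterval, ℂ), i < n + 1 →
      (∀ t, r < ‖f t - ((i / n : ℝ) : ℂ)‖ ∧ ‖f t - ((i / n : ℝ) : ℂ)‖ < s) ∧
      ((i / n : ℝ) : ℂ) ∈ insideSet (range f) ∧
      ∀ γ ∈ C, ((i / n : ℝ) : ℂ) ∉ inside γ → ∀ t, f t ∉ inside γ := by
    intro i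
    by_cases hi : i < n + 1
    · obtain ⟨f, hf⟩ := hcirc i hi
      exact ⟨f, fun _ => hf⟩
    · exact ⟨0, fun h => absurd h hi⟩
  choose f hf using hcirc'
  obtain ⟨L, hL, -, hLsub, hLfill⟩ := exists_isPathConnected_fill (l := fun i => range (f i))
    (fun i => isPathConnected_range_curve (f i))
    (fun i => (isCompact_range (f i).continuous).isClosed) n (by
      intro i hi
      obtain ⟨h1, h2, -⟩ := hf i (by omega)
      refine ⟨((i + 1 : ℕ) / n : ℝ), Or.inr ?_, Or.inr (hf (i + 1) (by omega)).2.1⟩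
      refine subset_insideSet_of_isPreconnected (s := Metric.ball ((i / n : ℝ) : ℂ) r)
        (convex_ball _ _).isPreconnected ?_ (Metric.mem_ball_self hr) h2 ?_
      · rw [disjoint_right]
        rintro _ ⟨t, rfl⟩ h
        exact (h1 t).1.not_gt (mem_ball_iff_norm.1 h)
      · rw [mem_ball_iff_norm, ← Complex.ofReal_sub, Complex.norm_real]
        push_cast
        rw [← sub_div, add_sub_cancel_left, Real.norm_eq_abs, abs_of_pos (by positivity)]
        exact hnr)
  have hLmem : ∀ x ∈ L, ∃ i < n + 1, x ∈ range (f i) := fun x hx => by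
    simpa using hLsub hx
  -- A loop that covers a point of the circuit also surrounds its centre, at distance more than `r`,
  -- which is too far for a loop of diameter at most `r / 4`.
  have hfreeL : L ⊆ free ε 1 C := by
    intro x hx γ hγ hγr hin
    obtain ⟨i, hi, t, rfl⟩ := hLmem x hx
    obtain ⟨h1, -, h3⟩ := hf i hi
    have hz : ((i / n : ℝ) : ℂ) ∈ inside γ := by
      by_contra hz
      exact h3 γ hγ hz t hin
    obtain ⟨y, hy⟩ := γ.nonempty
    have hγy : (γ : Set ℂ) ⊆ Metric.ball y (r / 2) := fun w hw => by
      have := hsmall γ hγ (fun v hv => mem_ball_zero_iff.2 (hγr hv).2) w hw y hy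
      rw [Metric.mem_ball]
      linarith
    have d1 := Metric.mem_ball.1 (insideSet_subset_ball hγy hin)
    have d2 := Metric.mem_ball.1 (insideSet_subset_ball hγy hz)
    have d3 := dist_triangle_right (f i t) ((i / n : ℝ) : ℂ) y
    have d4 := (h1 t).1
    rw [← dist_eq_norm] at d4
    linarith
  have h0 : (0 : ℂ) ∈ L ∪ insideSet L :=
    hLfill 0 (Nat.zero_le _) (Or.inr (by simpa using (hf 0 (by omega)).2.1))
  have h1 : (1 : ℂ) ∈ L ∪ insideSet L :=
    hLfill n le_rfl (Or.inr (by simpa [hn'.ne'] using (hf n (by omega)).2.1))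
  obtain ⟨t, ht, htL⟩ := exists_mem_ray h0 (v := -1) (by simp)
  obtain ⟨u, hu, huL⟩ := exists_mem_ray h1 (v := 1) one_ne_zero
  have htε : t < ε := by
    obtain ⟨i, hi, v, hv⟩ := hLmem _ htL
    have := ((hf i hi).1 v).2
    rw [hv] at this
    have hq : (0 : ℝ) ≤ i / n := by positivity
    have he : (0 : ℂ) + t * -1 - ((i / n : ℝ) : ℂ) = ((-(t + i / n) : ℝ) : ℂ) := by
      push_cast; ring
    rw [he, Complex.norm_real, norm_neg, Real.norm_eq_abs, abs_of_nonneg (by positivity)] at this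
    linarith
  -- No loop of the ring meets the disk of radius `ε`, so each one surrounds all of it or none; the
  -- endpoint in `L` rules out the former.
  have hseg : JoinedIn (free ε 1 C) 0 (0 + t * -1) := by
    refine JoinedIn.mono (U := Metric.ball 0 ε) ?_ ?_
    · exact ((convex_ball _ _).isPathConnected ⟨0, Metric.mem_ball_self (ht.trans_lt htε)⟩).joinedIn
        _ (Metric.mem_ball_self (ht.trans_lt htε)) _ (by simpa [abs_of_nonneg ht] using htε)
    · intro z hz γ hγ hγr hin
      refine hfreeL htL γ hγ hγr (subset_insideSet_of_isPreconnected (s := Metric.ball 0 ε)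
        (convex_ball _ _).isPreconnected ?_ hz hin (by simpa [abs_of_nonneg ht] using htε))
      rw [disjoint_right]
      exact fun w hw hwε => (hγr hw).1.not_gt (mem_ball_zero_iff.1 hwε)
  refine hasPath_of_joinedIn zero_le_one (hseg.trans ((hL.joinedIn _ htL _ huL).mono hfreeL)) ?_
  have he : (1 : ℂ) + u * 1 = ((1 + u : ℝ) : ℂ) := by push_cast; ring
  rw [he, Complex.norm_real, Real.norm_eq_abs, abs_of_nonneg (by positivity)]
  linarith

end Gluing

/-! ### From approximate additivity to an exponent. -/

section Growth

/-- A nonnegative nondecreasing function that is superadditive and almost subadditive is linear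
up to a bounded error. -/
theorem exists_linear_growth {g : ℝ → ℝ} {r C : ℝ} (hr : 0 < r) (hC : 0 ≤ C)
    (h0 : ∀ t > 0, 0 ≤ g t) (hmono : ∀ s t, 0 < s → s ≤ t → g s ≤ g t)
    (hsup : ∀ s > 0, ∀ t > 0, g s + g t ≤ g (s + t))
    (hsub : ∀ s > r, ∀ t > r, g (s + t) ≤ g s + g (t + r) + C) (hpos : ∃ t > 0, 0 < g t) :
    ∃ α c : ℝ, 0 < α ∧ ∀ t > 0, g t ≤ α * t ∧ α * t - c ≤ g t := by
  have hmul : ∀ s > 0, ∀ n : ℕ, (n + 1) * g s ≤ g ((n + 1) * s) := by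
    intro s hs n
    induction n with
    | zero => simp
    | succ n ih =>
      have := hsup ((n + 1) * s) (by positivity) s hs
      have e : ((n + 1 : ℕ) + 1 : ℝ) * s = (n + 1) * s + s := by push_cast; ring
      rw [e]
      push_cast
      linarith
  have hmul' : ∀ t > r, ∀ n : ℕ, g ((n + 1) * t + r) + C ≤ (n + 1) * (g (t + r) + C) := by
    intro t ht n
    induction n with
    | zero => simp
    | succ n ih =>
      have hnt : 0 < (n + 1) * t := by have := hr.trans ht; positivity
      have := hsub ((n + 1) * t + r) (by linarith) t ht
      have e : ((n + 1 : ℕ) + 1 : ℝ) * t + r = (n + 1) * t + r + t := by push_cast; ring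
      rw [e]
      push_cast
      linarith
  -- Compare `m` steps of length `s` with `n + 1` steps of length `t`, where `m s ≤ (n + 1) t < (m +
  -- 1) s`. The rounding costs at most one `g s`, negligible for large `n`.
  have key : ∀ s > 0, ∀ t > r, g s / s ≤ (g (t + r) + C) / t := by
    intro s hs t ht
    have ht0 := hr.trans ht
    rw [div_le_div_iff₀ hs ht0]
    by_contra! hlt
    obtain ⟨n, hn⟩ := exists_nat_gt (g s * s / (g s * t - (g (t + r) + C) * s))
    rw [div_lt_iff₀ (by linarith)] at hn
    have hd : 0 < g s * t - (g (t + r) + C) * s := by linarith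
    have hgs := h0 s hs
    obtain ⟨m, hm1, hm2⟩ : ∃ m : ℕ, (m : ℝ) * s ≤ (n + 1) * t ∧ (n + 1) * t < (m + 1) * s := by
      refine ⟨⌊(n + 1) * t / s⌋₊, ?_, ?_⟩
      · rw [← le_div_iff₀ hs]
        exact Nat.floor_le (by positivity)
      · rw [← div_lt_iff₀ hs]
        exact Nat.lt_floor_add_one _
    have h1 : (m : ℝ) * g s ≤ (n + 1) * (g (t + r) + C) := by
      rcases m with _ | m
      · have := h0 (t + r) (by linarith)
        simp only [Nat.cast_zero, zero_mul]
        positivity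
      · push_cast at hm1 ⊢
        have := hmul s hs m
        have := hmul' t ht n
        have := hmono ((m + 1) * s) ((n + 1) * t + r) (by positivity) (by linarith)
        linarith
    have h2 : ((n : ℝ) + 1) * t * g s ≤ (m + 1) * s * g s :=
      mul_le_mul_of_nonneg_right hm2.le hgs
    have h3 : (m : ℝ) * g s * s ≤ (n + 1) * (g (t + r) + C) * s :=
      mul_le_mul_of_nonneg_right h1 hs.le
    nlinarith
  let S : Set ℝ := (fun s => g s / s) '' Ioi 0
  have hbdd : BddAbove S := ⟨(g (2 * r + r) + C) / (2 * r), by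
    rintro _ ⟨s, hs, rfl⟩
    exact key s hs (2 * r) (by linarith)⟩
  have hne : S.Nonempty := ⟨_, 1, mem_Ioi.2 one_pos, rfl⟩
  have hle : ∀ s > 0, g s / s ≤ sSup S := fun s hs => le_csSup hbdd ⟨s, hs, rfl⟩
  have hα : 0 < sSup S := by
    obtain ⟨t, ht, hgt⟩ := hpos
    exact (div_pos hgt ht).trans_le (hle t ht)
  -- The term `2 α r` makes the lower bound trivial for `t ≤ 2 r`; beyond, `key` at `t - r` costs
  -- only `α r + C`.
  refine ⟨sSup S, 2 * sSup S * r + C, hα, fun t ht => ⟨?_, ?_⟩⟩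
  · rw [← div_le_iff₀ ht]
    exact hle t ht
  · rcases le_or_gt t (2 * r) with h | h
    · have := h0 t ht
      nlinarith
    · have h1 : sSup S ≤ (g (t - r + r) + C) / (t - r) := csSup_le hne (by
        rintro _ ⟨s, hs, rfl⟩
        exact key s hs (t - r) (by linarith))
      rw [le_div_iff₀ (by linarith), sub_add_cancel] at h1
      nlinarith

/-- The growth lemma for `g t = -log (f (exp (-t)))` with `r = log R`: products become sums, and
dividing by `R` is a shift by `r`. -/
theorem exists_exponent {f : ℝ → ℝ} {k R : ℝ} (hk : 0 < k) (hR : 2 < R)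
    (hf0 : ∀ x ∈ Ioo (0 : ℝ) 1, 0 < f x) (hf1 : ∀ x ∈ Ioo (0 : ℝ) 1, f x ≤ 1)
    (hmono : MonotoneOn f (Ioo 0 1))
    (hup : ∀ x ∈ Ioo (0 : ℝ) 1, ∀ y ∈ Ioo (0 : ℝ) 1, f (x * y) ≤ f x * f y)
    (hlow : ∀ x ∈ Ioo (0 : ℝ) (1 / R), ∀ y ∈ Ioo (0 : ℝ) (1 / R),
      k * f x * f (y / R) ≤ f (x * y))
    (hlt : ∃ x ∈ Ioo (0 : ℝ) 1, f x < 1) :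
    ∃ α k' : ℝ, 0 < α ∧ 0 < k' ∧ ∀ x ∈ Ioo (0 : ℝ) 1, x ^ α ≤ f x ∧ f x ≤ k' * x ^ α := by
  have hR0 : 0 < R := by linarith
  have hmem : ∀ t > 0, Real.exp (-t) ∈ Ioo (0 : ℝ) 1 := fun t ht =>
    ⟨Real.exp_pos _, by simpa using ht⟩
  have hmemR : ∀ t > Real.log R, Real.exp (-t) ∈ Ioo (0 : ℝ) (1 / R) := fun t ht => by
    refine ⟨Real.exp_pos _, ?_⟩
    rw [one_div, ← Real.exp_log (inv_pos.2 hR0), Real.log_inv]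
    exact Real.exp_lt_exp.2 (by linarith)
  obtain ⟨α, c, hα, h⟩ := exists_linear_growth (g := fun t => -Real.log (f (Real.exp (-t))))
    (r := Real.log R) (C := |Real.log k|) (Real.log_pos (by linarith)) (abs_nonneg _)
    (fun t ht => by
      have := Real.log_nonpos (hf0 _ (hmem t ht)).le (hf1 _ (hmem t ht))
      linarith)
    (fun s t hs hst => by
      have := Real.log_le_log (hf0 _ (hmem t (hs.trans_le hst)))
        (hmono (hmem t (hs.trans_le hst)) (hmem s hs) (Real.exp_le_exp.2 (by linarith)))
      linarith)
    (fun s hs t ht => by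
      have h1 := hup _ (hmem s hs) _ (hmem t ht)
      rw [← Real.exp_add] at h1
      have h2 := Real.log_le_log (hf0 _ (by rw [← neg_add]; exact hmem _ (by linarith))) h1
      rw [Real.log_mul (hf0 _ (hmem s hs)).ne' (hf0 _ (hmem t ht)).ne'] at h2
      rw [neg_add]
      linarith)
    (fun s hs t ht => by
      have hlogR : 0 < Real.log R := Real.log_pos (by linarith)
      have h1 := hlow _ (hmemR s hs) _ (hmemR t ht)
      have e : Real.exp (-t) / R = Real.exp (-(t + Real.log R)) := by
        rw [neg_add, Real.exp_add, Real.exp_neg (Real.log R), Real.exp_log hR0]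
        rfl
      rw [← Real.exp_add, e] at h1
      have p1 := hf0 _ (hmem s (by linarith))
      have p2 := hf0 _ (hmem (t + Real.log R) (by linarith))
      have h2 := Real.log_le_log (by positivity) h1
      rw [Real.log_mul (by positivity) p2.ne', Real.log_mul hk.ne' p1.ne'] at h2
      have := neg_abs_le (Real.log k)
      rw [neg_add]
      linarith)
    (by
      obtain ⟨x, hx, hfx⟩ := hlt
      refine ⟨-Real.log x, by have := Real.log_neg hx.1 hx.2; linarith, ?_⟩
      rw [neg_neg, Real.exp_log hx.1]
      have := Real.log_neg (hf0 x hx) hfx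
      linarith)
  refine ⟨α, Real.exp c, hα, Real.exp_pos _, fun x hx => ?_⟩
  obtain ⟨h1, h2⟩ := h (-Real.log x) (by have := Real.log_neg hx.1 hx.2; linarith)
  simp only [neg_neg, Real.exp_log hx.1] at h1 h2
  rw [Real.rpow_def_of_pos hx.1, ← Real.exp_add]
  constructor
  · rw [← Real.le_log_iff_exp_le (hf0 x hx)]
    linarith
  · rw [← Real.log_le_iff_le_exp (hf0 x hx)]
    linarith

end Growth

/-! ### Finite and positive masses of sets of loops. -/

section Mass

variable {μ : Measure Curve}

theorem exists_thin_ball (hμ : IsInvariantMeasure μ) (hthin : IsThin μ) :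
    ∃ R₀ > 0, ∀ (a : ℂ) (ρ : ℝ), 0 < ρ →
      μ {γ | ((γ : Set ℂ) ∩ Metric.ball a ρ).Nonempty ∧ ρ * R₀ ≤ Metric.diam (γ : Set ℂ)} < ∞ := by
  obtain ⟨R₀, hR₀, hfin⟩ := hthin
  refine ⟨R₀, hR₀, fun a ρ hρ => ?_⟩
  set W := {γ : Curve | ((γ : Set ℂ) ∩ Metric.ball 0 1).Nonempty ∧ R₀ ≤ Metric.diam (γ : Set ℂ)}
  have hT := hμ.measurePreserving_recenter a hρ
  refine lt_of_le_of_lt (measure_mono fun γ hγ => ?_)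
    ((hT.measure_preimage (measurableSet_toMeasurable μ W).nullMeasurableSet).trans_lt
      ((measure_toMeasurable W).trans_lt hfin))
  refine subset_toMeasurable μ W ⟨?_, ?_⟩
  · obtain ⟨z, hz, hza⟩ := hγ.1
    refine ⟨recenterHomeomorph a hρ z, ?_, ?_⟩
    · rw [coe_recenter a hρ]
      exact ⟨z, hz, rfl⟩
    · rw [mem_ball_zero_iff, norm_recenterHomeomorph, div_lt_one hρ]
      exact mem_ball_iff_norm.1 hza
  · have hle : Metric.diam (γ : Set ℂ) ≤ ρ * Metric.diam (recenter a ρ γ : Set ℂ) := by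
      refine Metric.diam_le_of_forall_dist_le (by positivity) fun x hx y hy => ?_
      have hd : dist x y = ρ * dist (recenterHomeomorph a hρ x) (recenterHomeomorph a hρ y) := by
        rw [recenterHomeomorph_apply, recenterHomeomorph_apply, dist_eq_norm, dist_eq_norm,
          ← mul_sub, add_sub_add_left_eq_sub, norm_mul, Complex.norm_real, Real.norm_eq_abs,
          abs_of_pos (inv_pos.2 hρ), mul_inv_cancel_left₀ hρ.ne']
      rw [hd]
      refine mul_le_mul_of_nonneg_left ?_ hρ.le
      have hb : Bornology.IsBounded (recenter a ρ γ : Set ℂ) := (recenter a ρ γ).isCompact.isBounded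
      rw [coe_recenter a hρ] at hb ⊢
      exact Metric.dist_le_diam_of_mem hb ⟨x, hx, rfl⟩ ⟨y, hy, rfl⟩
    exact le_of_mul_le_mul_left (hγ.2.trans hle) hρ

/-- The curves that cross the ring `{1 < |z| < R}`. -/
def crossing (R : ℝ) : Set Curve :=
  {γ | ((γ : Set ℂ) ∩ Metric.closedBall 0 1).Nonempty ∧ ((γ : Set ℂ) ∩ (Metric.ball 0 R)ᶜ).Nonempty}

theorem measurableSet_crossing (R : ℝ) : MeasurableSet (crossing R) :=
  (NonemptyCompacts.isClosed_inter_nonempty_of_isClosed Metric.isClosed_closedBall).measurableSet.inter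
    (NonemptyCompacts.isClosed_inter_nonempty_of_isClosed
      Metric.isOpen_ball.isClosed_compl).measurableSet

theorem exists_measure_crossing_lt_top (hμ : IsInvariantMeasure μ) (hthin : IsThin μ) :
    ∃ R₁ : ℝ, ∀ R ≥ R₁, μ (crossing R) ≠ ∞ := by
  obtain ⟨R₀, hR₀, h⟩ := exists_thin_ball hμ hthin
  refine ⟨2 * R₀ + 1, fun R hR => (lt_of_le_of_lt (measure_mono ?_) (h 0 2 two_pos)).ne⟩
  rintro γ ⟨⟨x, hx, hx1⟩, ⟨y, hy, hyR⟩⟩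
  refine ⟨⟨x, hx, Metric.closedBall_subset_ball one_lt_two hx1⟩, ?_⟩
  have h1 := Metric.dist_le_diam_of_mem γ.isCompact.isBounded hy hx
  have h2 : R ≤ ‖y‖ := by simpa using hyR
  have h3 := mem_closedBall_zero_iff.1 hx1
  have h4 := norm_sub_norm_le y x
  rw [dist_eq_norm] at h1
  linarith

/-- The curves in the unit disk that have two points at distance larger than `δ`. -/
def bigInDisk (δ : ℝ) : Set Curve :=
  {γ | (γ : Set ℂ) ⊆ Metric.ball 0 1 ∧ ∃ x ∈ (γ : Set ℂ), ∃ y ∈ (γ : Set ℂ), δ < dist x y}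

theorem measurableSet_bigInDisk (δ : ℝ) : MeasurableSet (bigInDisk δ) := by
  suffices hopen : IsOpen {γ : Curve | ∃ x ∈ (γ : Set ℂ), ∃ y ∈ (γ : Set ℂ), δ < dist x y} from
    ((isOpen_curve_subset Metric.isOpen_ball).inter hopen).measurableSet
  rw [isOpen_iff_forall_mem_open]
  rintro γ ⟨x, hx, y, hy, hxy⟩
  have ht : 0 < (dist x y - δ) / 2 := by linarith
  refine ⟨{γ : Curve | ((γ : Set ℂ) ∩ Metric.ball x ((dist x y - δ) / 2)).Nonempty} ∩
    {γ | ((γ : Set ℂ) ∩ Metric.ball y ((dist x y - δ) / 2)).Nonempty}, ?_,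
    (NonemptyCompacts.isOpen_inter_nonempty_of_isOpen Metric.isOpen_ball).inter
      (NonemptyCompacts.isOpen_inter_nonempty_of_isOpen Metric.isOpen_ball),
    ⟨x, hx, Metric.mem_ball_self ht⟩, ⟨y, hy, Metric.mem_ball_self ht⟩⟩
  rintro γ' ⟨⟨x', hx', hxx⟩, ⟨y', hy', hyy⟩⟩
  refine ⟨x', hx', y', hy', ?_⟩
  have h1 := Metric.mem_ball'.1 hxx
  have h2 := Metric.mem_ball.1 hyy
  have h3 := dist_triangle4 x x' y' y
  linarith

theorem measure_bigInDisk_ne_top (hμ : IsInvariantMeasure μ) (hthin : IsThin μ) {δ : ℝ}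
    (hδ : 0 < δ) : μ (bigInDisk δ) ≠ ∞ := by
  obtain ⟨R₀, hR₀, h⟩ := exists_thin_ball hμ hthin
  have hρ : 0 < δ / R₀ := by positivity
  obtain ⟨t, -, htfin, ht⟩ := (isCompact_closedBall (0 : ℂ) 1).finite_cover_balls hρ
  refine (lt_of_le_of_lt (measure_mono ?_)
    (measure_biUnion_lt_top htfin fun a _ => h a (δ / R₀) hρ)).ne
  rintro γ ⟨hγ, x, hx, y, hy, hxy⟩
  obtain ⟨a, ha, hxa⟩ := mem_iUnion₂.1 (ht (Metric.ball_subset_closedBall (hγ hx)))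
  refine mem_iUnion₂.2 ⟨a, ha, ⟨x, hx, hxa⟩, ?_⟩
  rw [div_mul_cancel₀ _ hR₀.ne']
  exact hxy.le.trans (Metric.dist_le_diam_of_mem γ.isCompact.isBounded hx hy)

/-- If almost no loop surrounded `0`, then by translation almost none would surround any point of a
countable dense set; but interiors are open and nonempty, so `μ` would vanish. The surrounding loops
are exhausted by rings, one of which is rescaled into the unit disk. -/
theorem exists_measure_surrounding_pos (hμ : IsInvariantMeasure μ)
    (hloop : ∀ᵐ γ ∂μ, IsSimpleLoop γ) :
    ∃ ε ∈ Ioo (0 : ℝ) 1, μ ({γ | (0 : ℂ) ∈ inside γ} ∩ {γ | (γ : Set ℂ) ⊆ ring ε 1}) ≠ 0 := by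
  have hpos : μ {γ | (0 : ℂ) ∈ inside γ} ≠ 0 := by
    intro h0
    have hq : ∀ i, ∀ᵐ γ ∂μ, denseSeq ℂ i ∉ inside γ := by
      intro i
      have hT := hμ.measurePreserving_recenter (denseSeq ℂ i) one_pos
      rw [← hT.measure_preimage (measurableSet_mem_inside 0).nullMeasurableSet] at h0
      refine measure_mono_null (fun γ hγ => ?_) h0
      simp only [mem_compl_iff, mem_ofPred_eq, not_not] at hγ
      change (0 : ℂ) ∈ inside (recenter _ _ γ)
      rw [inside_recenter _ one_pos]
      exact ⟨_, hγ, by simp [recenterHomeomorph_apply]⟩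
    have hfalse : ∀ᵐ γ ∂μ, False := by
      filter_upwards [ae_all_iff.2 hq, hloop] with γ h1 h2
      obtain ⟨x, hx⟩ := (denseRange_denseSeq ℂ).inter_open_nonempty _
        (isOpen_insideSet γ.isCompact.isClosed) h2.nonempty_inside
      obtain ⟨hx1, i, rfl⟩ := hx
      exact h1 i hx1
    rw [ae_iff] at hfalse
    exact hμ.not_one_dimensional 0 (measure_mono_null (fun _ _ => by simp) hfalse)
  have hcover : {γ : Curve | (0 : ℂ) ∈ inside γ} ⊆
      ⋃ n : ℕ, {γ | (0 : ℂ) ∈ inside γ} ∩ {γ | (γ : Set ℂ) ⊆ ring (1 / (n + 2)) (n + 2)} := by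
    intro γ hγ
    obtain ⟨B, hB⟩ := γ.isCompact.isBounded.subset_ball 0
    obtain ⟨δ, hδ, hball⟩ := Metric.isOpen_iff.1 γ.isCompact.isClosed.isOpen_compl 0 hγ.1
    obtain ⟨m₁, hm₁⟩ := exists_nat_ge B
    obtain ⟨m₂, hm₂⟩ := exists_nat_one_div_lt hδ
    refine mem_iUnion.2 ⟨max m₁ m₂, hγ, fun z hz => ⟨?_, ?_⟩⟩
    · have h1 : δ ≤ ‖z‖ := by
        by_contra hlt
        exact hball (mem_ball_zero_iff.2 (not_le.1 hlt)) hz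
      refine lt_of_le_of_lt ?_ (hm₂.trans_le h1)
      apply one_div_le_one_div_of_le (by positivity)
      push_cast
      have := le_max_right (m₁ : ℝ) m₂
      linarith
    · have h1 := mem_ball_zero_iff.1 (hB hz)
      have h2 : (m₁ : ℝ) ≤ (max m₁ m₂ : ℕ) := by exact_mod_cast le_max_left _ _
      linarith
  obtain ⟨n, hn⟩ : ∃ n : ℕ, μ ({γ | (0 : ℂ) ∈ inside γ} ∩
      {γ | (γ : Set ℂ) ⊆ ring (1 / (n + 2)) (n + 2)}) ≠ 0 := by
    by_contra! hcon
    exact hpos (measure_mono_null hcover (measure_iUnion_null hcon))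
  have hn2 : (0 : ℝ) < n + 2 := by positivity
  refine ⟨1 / (n + 2) / (n + 2), ⟨by positivity, ?_⟩, fun h0 => hn ?_⟩
  · rw [div_div, div_lt_one (by positivity)]
    have : (0 : ℝ) ≤ n := Nat.cast_nonneg n
    nlinarith
  · have hT := hμ.measurePreserving_recenter 0 hn2
    have hmeas : MeasurableSet ({γ : Curve | (0 : ℂ) ∈ inside γ} ∩
        {γ | (γ : Set ℂ) ⊆ ring (1 / (n + 2) / (n + 2)) 1}) :=
      (measurableSet_mem_inside 0).inter (isOpen_curve_subset (isOpen_ring _ _)).measurableSet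
    rw [← hT.measure_preimage hmeas.nullMeasurableSet] at h0
    refine measure_mono_null (fun γ hγ => ?_) h0
    refine mem_preimage.2 (mem_inter ?_ ?_)
    · change (0 : ℂ) ∈ inside (recenter _ _ γ)
      rw [inside_recenter _ hn2]
      exact ⟨0, hγ.1, by simp [recenterHomeomorph_apply]⟩
    · change (recenter _ _ γ : Set ℂ) ⊆ _
      rw [coe_recenter _ hn2]
      rintro _ ⟨z, hz, rfl⟩
      have := hγ.2 hz
      simp only [ring, mem_ofPred_eq, norm_recenterHomeomorph, sub_zero] at this ⊢
      exact ⟨div_lt_div_of_pos_right this.1 hn2, (div_lt_one hn2).2 this.2⟩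

end Mass

/-! ### Probability estimates for the soup. -/

section Soup

variable {Ω : Type*} [MeasurableSpace Ω] {P : Measure Ω}
  {μ : Measure Curve} {Γ : Ω → Set Curve}

theorem IsSubcritical.exists_hasCircuit_pos (hsub : IsSubcritical P Γ) :
    ∃ m₀ : ℕ, ∀ m : ℕ, m₀ ≤ m → 0 < P {ω | HasCircuit 0 (1 / (m + 1)) (m + 1) (Γ ω)} := by
  obtain ⟨m₀, hm₀⟩ : ∃ m : ℕ, P {ω | HasCircuit 0 (1 / (m + 1)) (m + 1) (Γ ω)} ≠ 0 := by
    by_contra! hcon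
    refine hsub.ne' (measure_mono_null ?_ (measure_iUnion_null hcon))
    rintro ω ⟨l, hl, h0, hl'⟩
    exact mem_iUnion.2 (hl.exists_hasCircuit h0 hl')
  refine ⟨m₀, fun m hm => (pos_iff_ne_zero.2 hm₀).trans_le (measure_mono fun ω h => h.mono ?_ ?_)⟩
  · have : (m₀ : ℝ) ≤ m := by exact_mod_cast hm
    exact one_div_le_one_div_of_le (by positivity) (by linarith)
  · have : (m₀ : ℝ) ≤ m := by exact_mod_cast hm
    linarith

variable [IsProbabilityMeasure P]

theorem measure_hasPath_scale (hμ : IsInvariantMeasure μ) (hΓ : IsPoissonPointProcess P Γ μ)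
    {ρ : ℝ} (hρ : 0 < ρ) (r R : ℝ) :
    P {ω | HasPath (ρ * r) (ρ * R) (Γ ω)} = P {ω | HasPath r R (Γ ω)} := by
  rw [← hΓ.measure_image (isDecreasing_hasPath r R) (hμ.measurePreserving_recenter 0 hρ)]
  simp only [hasPath_recenter_iff hρ]

theorem measure_hasCircuit_le (hμ : IsInvariantMeasure μ) (hΓ : IsPoissonPointProcess P Γ μ)
    (a : ℂ) {ρ : ℝ} (hρ : 0 < ρ) (r R : ℝ) :
    P {ω | HasCircuit 0 r R (Γ ω)} ≤ P {ω | HasCircuit a (ρ * r) (ρ * R) (Γ ω)} := by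
  rw [← hΓ.measure_image (isDecreasing_hasCircuit 0 r R) (hμ.measurePreserving_recenter a hρ)]
  exact measure_mono fun ω h => HasCircuit.of_recenter hρ h

theorem measure_hasPath_mul_le (hμ : IsInvariantMeasure μ) (hΓ : IsPoissonPointProcess P Γ μ)
    {ε ε' : ℝ} (hε : ε ∈ Ioo (0 : ℝ) 1) (hε' : ε' ∈ Ioo (0 : ℝ) 1) :
    P {ω | HasPath (ε * ε') 1 (Γ ω)} ≤
      P {ω | HasPath ε 1 (Γ ω)} * P {ω | HasPath ε' 1 (Γ ω)} := by
  have hd : Disjoint {γ : Curve | (γ : Set ℂ) ⊆ ring ε 1}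
      {γ : Curve | (γ : Set ℂ) ⊆ ring (ε * ε') ε} := disjoint_left.2 fun γ h1 h2 => by
    obtain ⟨x, hx⟩ := γ.nonempty
    exact (h1 hx).1.not_gt (h2 hx).2
  have hprod := hΓ.measure_and_of_disjoint (isDecreasing_hasPath ε 1)
    (isDecreasing_hasPath (ε * ε') ε) (isOpen_curve_subset (isOpen_ring _ _)).measurableSet
    (isOpen_curve_subset (isOpen_ring _ _)).measurableSet hd
  simp only [hasPath_inter_iff] at hprod
  have hscale := measure_hasPath_scale hμ hΓ hε.1 ε' 1
  rw [mul_one] at hscale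
  rw [← hscale, ← hprod]
  refine measure_mono fun ω h => ⟨h.mono ?_ zero_le_one le_rfl, h.mono le_rfl hε.1.le hε.2.le⟩
  exact mul_le_of_le_one_right hε.1.le hε'.2.le

theorem exists_le_measure_hasPath_mul (hμ : IsInvariantMeasure μ)
    (hloop : ∀ᵐ γ ∂μ, IsSimpleLoop γ) (hthin : IsThin μ) (hΓ : IsPoissonPointProcess P Γ μ)
    (hsub : IsSubcritical P Γ) :
    ∃ (k : ℝ≥0∞) (R : ℝ), 0 < k ∧ k ≠ ∞ ∧ 2 < R ∧
      ∀ ε ∈ Ioo (0 : ℝ) (1 / R), ∀ ε' ∈ Ioo (0 : ℝ) (1 / R),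
        k * P {ω | HasPath ε 1 (Γ ω)} * P {ω | HasPath (ε' / R) 1 (Γ ω)} ≤
          P {ω | HasPath (ε * ε') 1 (Γ ω)} := by
  obtain ⟨R₁, hR₁⟩ := exists_measure_crossing_lt_top hμ hthin
  obtain ⟨m₀, hm₀⟩ := hsub.exists_hasCircuit_pos
  obtain ⟨m₁, hm₁⟩ := exists_nat_ge R₁
  let m : ℕ := max m₀ (max m₁ 1)
  have hmm₁ : (m₁ : ℝ) ≤ m := by
    exact_mod_cast (le_max_left m₁ 1).trans (le_max_right _ _)
  have hm1 : (1 : ℝ) ≤ m := by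
    exact_mod_cast (le_max_right m₁ 1).trans (le_max_right _ _)
  -- The ratio of the radii of the circuit's ring; scaling by `ε (m + 1)` turns that ring into `{ε <
  -- |z| < R ε}`.
  let R : ℝ := (m + 1) * (m + 1)
  have hR2 : 2 < R := by simp only [R]; nlinarith
  have hRR₁ : R₁ ≤ R := by simp only [R]; nlinarith
  have hcirc := hm₀ m (le_max_left _ _)
  have hvoid := hΓ.void_pos (measurableSet_crossing R) (hR₁ R hRR₁)
  -- Simplicity of all loops is encoded as vacancy of a measurable null set, a decreasing event of
  -- probability one that can join the FKG chain.
  obtain ⟨N, hNsub, hNm, hN0⟩ := exists_measurable_superset_of_null (ae_iff.1 hloop)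
  have hNone : P {ω | Γ ω ∩ N = ∅} = 1 := by
    rw [hΓ.measure_void hNm, hN0]
    simp [voidProb]
  refine ⟨P {ω | HasCircuit 0 (1 / (m + 1)) (m + 1) (Γ ω)} * P {ω | Γ ω ∩ crossing R = ∅}, R,
    ENNReal.mul_pos hcirc.ne' hvoid.ne',
    ENNReal.mul_ne_top (measure_ne_top _ _) (measure_ne_top _ _), hR2, fun ε hε ε' hε' => ?_⟩
  have hR0 : 0 < R := by linarith
  have hε0 := hε.1
  have hRε : 0 < R * ε := by positivity
  have hRε1 : R * ε < 1 := by
    have := hε.2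
    rwa [lt_div_iff₀ hR0, mul_comm] at this
  have hρ : 0 < ε * (m + 1) := by positivity
  have hp2 := measure_hasPath_scale hμ hΓ hRε (ε' / R) 1
  rw [show R * ε * (ε' / R) = ε * ε' by field_simp, mul_one] at hp2
  have hp3 := measure_hasCircuit_le hμ hΓ 0 hρ (1 / (m + 1)) (m + 1)
  rw [show ε * (m + 1) * (1 / (m + 1)) = ε by field_simp,
    show ε * (m + 1) * (m + 1 : ℝ) = R * ε by simp only [R]; ring] at hp3
  have hdec4 := isDecreasing_inter_eq_empty (measurableSet_crossing R)
  have hp4 := hΓ.measure_image hdec4 (hμ.measurePreserving_recenter 0 hε0)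
  have hdec4' := hdec4.comp_image (hμ.measurePreserving_recenter 0 hε0).measurable
  have hdec1 := isDecreasing_hasPath ε 1
  have hdec2 := isDecreasing_hasPath (ε * ε') (R * ε)
  have hdec3 := isDecreasing_hasCircuit 0 ε (R * ε)
  have hdec5 := isDecreasing_inter_eq_empty hNm
  have i1 := hΓ.mul_le_measure_and hdec1 hdec2
  have i2 := hΓ.mul_le_measure_and hdec3 hdec4'
  have i3 := hΓ.mul_le_measure_and (hdec3.and hdec4') (hdec1.and hdec2)
  have i4 := hΓ.mul_le_measure_and ((hdec3.and hdec4').and (hdec1.and hdec2)) hdec5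
  rw [hNone, mul_one] at i4
  rw [hp4] at i2
  rw [hp2] at i1
  refine (le_trans ?_ (i3.trans i4)).trans (measure_mono ?_)
  · rw [mul_assoc]
    exact mul_le_mul' ((mul_le_mul_left hp3 _).trans i2) i1
  · rintro ω ⟨⟨⟨h3, h4⟩, h1, h2⟩, h5⟩
    refine h1.glue hε0.le hRε1.le (fun γ hγ => ?_) h2 h3 fun γ hγ => ?_
    · by_contra hγs
      exact (h5.subset ⟨hγ, hNsub hγs⟩).elim
    · by_contra! hcon
      obtain ⟨⟨x, hx, hxε⟩, ⟨y, hy, hyR⟩⟩ := And.intro (not_subset.1 hcon.1) (not_subset.1 hcon.2)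
      have hxε' : ‖x‖ ≤ ε := by simpa using hxε
      have hyR' : R * ε ≤ ‖y‖ := by simpa using hyR
      have hmem : recenter 0 ε γ ∈ recenter 0 ε '' Γ ω ∩ crossing R := by
        refine ⟨⟨γ, hγ, rfl⟩, ⟨recenterHomeomorph 0 hε0 x, ?_, ?_⟩,
          ⟨recenterHomeomorph 0 hε0 y, ?_, ?_⟩⟩
        · rw [coe_recenter 0 hε0]
          exact ⟨x, hx, rfl⟩
        · rw [mem_closedBall_zero_iff, norm_recenterHomeomorph, sub_zero]
          exact (div_le_one hε0).2 hxε'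
        · rw [coe_recenter 0 hε0]
          exact ⟨y, hy, rfl⟩
        · rw [mem_compl_iff, mem_ball_zero_iff, norm_recenterHomeomorph, sub_zero, not_lt]
          exact (le_div_iff₀ hε0).2 hyR'
      exact (h4.subset hmem).elim

/-- FKG applied to finitely many small circuits centred on `[0,1]` and to the absence of large loops
in the disk, an event of positive probability by thinness. -/
theorem measure_hasPath_pos (hμ : IsInvariantMeasure μ) (hthin : IsThin μ)
    (hΓ : IsPoissonPointProcess P Γ μ) (hsub : IsSubcritical P Γ) {ε : ℝ} (hε : 0 < ε) :
    0 < P {ω | HasPath ε 1 (Γ ω)} := by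
  obtain ⟨m, hm⟩ := hsub.exists_hasCircuit_pos
  have hcirc := hm m le_rfl
  have hm0 : (0 : ℝ) < m + 1 := by positivity
  -- Scaling by `2 (m + 1) / n` gives circuits of inner radius `2 / n`, more than the spacing `1 /
  -- n`, and this `n` makes the outer radius at most `ε`.
  obtain ⟨n, hn⟩ := exists_nat_gt (2 * (m + 1) * (m + 1) / ε)
  have hn0 : (0 : ℝ) < n := lt_trans (by positivity) hn
  have hnpos : 0 < n := by exact_mod_cast hn0
  rw [div_lt_iff₀ hε] at hn
  have hρ : (0 : ℝ) < 2 * (m + 1) / n := by positivity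
  have hr : 2 * ((m : ℝ) + 1) / n * (1 / (m + 1)) = 2 / n := by field_simp
  have hs : 2 * ((m : ℝ) + 1) / n * (m + 1) ≤ ε := by
    rw [div_mul_eq_mul_div, div_le_iff₀ hn0]
    linarith
  have hpos := hΓ.forall_lt_pos
    (Q := fun i => HasCircuit ((i / n : ℝ) : ℂ) (2 / n) (2 * (m + 1) / n * (m + 1)))
    (fun i => isDecreasing_hasCircuit _ _ _)
    (fun i => hcirc.trans_le (by
      have := measure_hasCircuit_le hμ hΓ ((i / n : ℝ) : ℂ) hρ (1 / (m + 1)) (m + 1)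
      rwa [hr] at this)) (n + 1)
  have hδ : (0 : ℝ) < 2 / n / 4 := by positivity
  have hvoid := hΓ.void_pos (measurableSet_bigInDisk (2 / n / 4))
    (measure_bigInDisk_ne_top hμ hthin hδ)
  refine (ENNReal.mul_pos hpos.ne' hvoid.ne').trans_le ((hΓ.mul_le_measure_and
    (IsDecreasing.forall_lt (fun i => isDecreasing_hasCircuit _ _ _) _)
    (isDecreasing_inter_eq_empty (measurableSet_bigInDisk _))).trans (measure_mono ?_))
  rintro ω ⟨h1, h2⟩
  refine hasPath_of_circuits hnpos (div_lt_div_of_pos_right one_lt_two hn0) hs h1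
    fun γ hγ hγ1 x hx y hy => ?_
  by_contra! hlt
  exact (h2.subset ⟨hγ, hγ1, x, hx, y, hy, hlt⟩).elim

/-- A loop of the ring that surrounds the origin blocks every path at its start. -/
theorem exists_measure_hasPath_lt_one (hμ : IsInvariantMeasure μ)
    (hloop : ∀ᵐ γ ∂μ, IsSimpleLoop γ) (hΓ : IsPoissonPointProcess P Γ μ) :
    ∃ ε ∈ Ioo (0 : ℝ) 1, P {ω | HasPath ε 1 (Γ ω)} < 1 := by
  obtain ⟨ε, hε, hpos⟩ := exists_measure_surrounding_pos hμ hloop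
  refine ⟨ε, hε, lt_of_le_of_lt (measure_mono ?_) (hΓ.void_lt_one
    ((measurableSet_mem_inside 0).inter (isOpen_curve_subset (isOpen_ring _ _)).measurableSet)
    hpos)⟩
  rintro ω ⟨w, -, hw⟩
  refine eq_empty_of_forall_notMem fun γ hγ => ?_
  exact hw.source_mem γ hγ.1 hγ.2.2 hγ.2.1

end Soup

end LoopSoup

theorem mainTheorem5 {Ω : Type*} [MeasurableSpace Ω] (P : MeasureTheory.Measure Ω)
    [MeasureTheory.IsProbabilityMeasure P]
    (μ : MeasureTheory.Measure LoopSoup.Curve)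
    (hμ : LoopSoup.IsInvariantMeasure μ)
    (hloop : ∀ᵐ γ ∂μ, LoopSoup.IsSimpleLoop γ)
    (hthin : LoopSoup.IsThin μ)
    (Γ : Ω → Set LoopSoup.Curve)
    (hΓ : LoopSoup.IsPoissonPointProcess P Γ μ)
    (hsub : LoopSoup.IsSubcritical P Γ) :
    (∃ k R : ℝ, 0 < k ∧ 2 < R ∧
      ∀ ε ∈ Set.Ioo (0 : ℝ) (1 / R), ∀ ε' ∈ Set.Ioo (0 : ℝ) (1 / R),
        k * P.real (LoopSoup.eventA Γ ε) * P.real (LoopSoup.eventA Γ (ε' / R))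
            ≤ P.real (LoopSoup.eventA Γ (ε * ε')) ∧
        P.real (LoopSoup.eventA Γ (ε * ε'))
            ≤ P.real (LoopSoup.eventA Γ ε) * P.real (LoopSoup.eventA Γ ε')) ∧
    (∃ α k' : ℝ, 0 < α ∧ 0 < k' ∧
      ∀ ε ∈ Set.Ioo (0 : ℝ) 1,
        ε ^ α ≤ P.real (LoopSoup.eventA Γ ε) ∧
        P.real (LoopSoup.eventA Γ ε) ≤ k' * ε ^ α) := by
  open LoopSoup Set in
  simp only [eventA_eq]
  obtain ⟨k, R, hk, hktop, hR, hlow⟩ := exists_le_measure_hasPath_mul hμ hloop hthin hΓ hsub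
  have hk' : 0 < k.toReal := ENNReal.toReal_pos hk.ne' hktop
  have hlow' : ∀ ε ∈ Ioo (0 : ℝ) (1 / R), ∀ ε' ∈ Ioo (0 : ℝ) (1 / R),
      k.toReal * P.real {ω | HasPath ε 1 (Γ ω)} * P.real {ω | HasPath (ε' / R) 1 (Γ ω)} ≤
        P.real {ω | HasPath (ε * ε') 1 (Γ ω)} := fun ε hε ε' hε' => by
    have := ENNReal.toReal_mono (measure_ne_top _ _) (hlow ε hε ε' hε')
    rwa [ENNReal.toReal_mul, ENNReal.toReal_mul] at this
  have hup : ∀ ε ∈ Ioo (0 : ℝ) 1, ∀ ε' ∈ Ioo (0 : ℝ) 1,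
      P.real {ω | HasPath (ε * ε') 1 (Γ ω)} ≤
        P.real {ω | HasPath ε 1 (Γ ω)} * P.real {ω | HasPath ε' 1 (Γ ω)} := fun ε hε ε' hε' => by
    have := ENNReal.toReal_mono (ENNReal.mul_ne_top (measure_ne_top _ _) (measure_ne_top _ _))
      (measure_hasPath_mul_le hμ hΓ hε hε')
    rwa [ENNReal.toReal_mul] at this
  have hsub1 : Ioo (0 : ℝ) (1 / R) ⊆ Ioo 0 1 := fun x hx =>
    ⟨hx.1, hx.2.trans ((div_lt_one (by linarith)).2 (by linarith))⟩
  refine ⟨⟨k.toReal, R, hk', hR, fun ε hε ε' hε' =>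
    ⟨hlow' ε hε ε' hε', hup ε (hsub1 hε) ε' (hsub1 hε')⟩⟩, ?_⟩
  refine exists_exponent (f := fun ε => P.real {ω | HasPath ε 1 (Γ ω)}) hk' hR
    (fun ε hε => ENNReal.toReal_pos (measure_hasPath_pos hμ hthin hΓ hsub hε.1).ne'
      (measure_ne_top _ _)) (fun ε _ => measureReal_le_one) ?_ hup hlow' ?_
  · exact fun ε _ ε' _ h => measureReal_mono fun ω hω => hω.mono h zero_le_one le_rfl
  · obtain ⟨ε, hε, hlt⟩ := exists_measure_hasPath_lt_one hμ hloop hΓ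
    refine ⟨ε, hε, ?_⟩
    have := (ENNReal.toReal_lt_toReal (measure_ne_top _ _) ENNReal.one_ne_top).2 hlt
    rwa [ENNReal.toReal_one] at this
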